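/- Let $n\ge 2$, let $Q$ be an open subset of a finite-dimensional real normed space $E$ (configuration space in generalized coordinates), $TQ=Q\times E$, and let $L:TQ\to\mathbb R$ be a Lagrangian of class $C^{2n}$ that is regular, i.e. $\partial^2L/\partial v^2(q,v)$ is nondegenerate at every $(q,v)\in TQ$. (No global bound on the partial derivatives of $L$ is needed; they are uniformly bounded on compact subsets of $TQ$, and the estimates below are for initial data in a relatively compact set.) For $h>0$ and $0\le j\le n-1$ let $$H_{n,j}(t)=\frac{t^{j}}{j!}\Big(1-\frac th\Big)^{n}\sum_{s=0}^{n-j-1}\binom{n+s-1}{s}\Big(\frac th\Big)^{s}.$$ A *prolongation-collocation curve* from $q_0$ to $q_1$ in time $h$ is a two-point Hermite polynomial of degree at most $2n-1$, $$q_d(t)=\sum_{j=0}^{n-1}\big(a_jH_{n,j}(t)+(-1)^jb_jH_{n,j}(h-t)\big),\qquad a_j,b_j\in E,$$ with $q_d(0)=q_0$, $q_d(h)=q_1$ such that, for $k=0,\dots,n-2$ and $\tau\in\{0,h\}$, $$\frac{d^k}{dt^k}\Big[\frac{\partial L}{\partial q}(q_d,\dot q_d)-\frac{d}{dt}\frac{\partial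 L}{\partial v}(q_d,\dot q_d)\Big]_{t=\tau}=0 .$$ With $m\ge0$ Euler--Maclaurin correction terms put $$L_d^{(m)}=\frac h2\big(L(q_d(0),\dot q_d(0))+L(q_d(h),\dot q_d(h))\big)-\sum_{l=1}^{m}\frac{B_{2l}}{(2l)!}h^{2l}\Big(\frac{d^{2l-1}}{dt^{2l-1}}L(q_d,\dot q_d)\Big|_{t=h}-\frac{d^{2l-1}}{dt^{2l-1}}L(q_d,\dot q_d)\Big|_{t=0}\Big),$$ where $B_{2l}$ are the Bernoulli numbers; $m=0$ is the trapezoidal rule, and the prolongation-collocation discrete Lagrangian is $L_d=L_d^{(\lfloor n/2\rfloor)}$. For a solution $q:[0,h]\to Q$ of the Euler--Lagrange equation, the exact discrete Lagrangian at its endpoints is $L_d^E(q(0),q(h),h)=\int_0^hL(q(t),\dot q(t))\,dt$. Let $U\subset TQ$ be open with compact closure contained in $TQ$, and let $R$ be such that $\|v\|<R$ for all $(q,v)\in\overline U$. Then there are constants $C$ and $h_0>0$ such that for all $0<h\le h_0$ and every solution $q:[0,h]\to Q$ of the Euler--Lagrange equation with $(q(0),\dot q(0))\in U$ there is exactly one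 prolongation-collocation curve $q_d$ from $q(0)$ to $q(h)$ in time $h$ with $\|\dot q_d(0)\|\le R$ and $\|\dot q_d(h)\|\le R$; it maps $[0,h]$ into $Q$, and the discrete Lagrangian built from it satisfies: * if $n\ge3$, then $|L_d(q(0),q(h),h)-L_d^E(q(0),q(h),h)|\le C\,h^{2\lfloor n/2\rfloor+3}$, that is, the error is $O(h^{n+3})$ for even $n$ and $O(h^{n+2})$ for odd $n$; * if $n=2$ (cubic Hermite interpolation), then $|L_d^{(0)}-L_d^E|\le C\,h^{3}$ for the trapezoidal rule, and the same bound holds for $L_d^{(1)}$. -/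

import Mathlib

open Set
open scoped Nat

noncomputable section

namespace PCVariational

variable {E : Type*} [NormedAddCommGroup E] [NormedSpace ℝ E]

/-- The partial derivative `∂L/∂q` of a Lagrangian at the phase point `z = (q, v)`. -/
def partialQ (L : E × E → ℝ) (z : E × E) : E →L[ℝ] ℝ :=
  fderiv ℝ (fun x => L (x, z.2)) z.1

/-- The partial derivative `∂L/∂v` of a Lagrangian at the phase point `z = (q, v)`. -/
def partialV (L : E × E → ℝ) (z : E × E) : E →L[ℝ] ℝ :=
  fderiv ℝ (fun w => L (z.1, w)) z.2

/-- The Lagrangian `L` is regular on `TQ = Q × E`: the fibre Hessian `∂²L/∂v²` is nondegenerate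
at every point (so that the Euler-Lagrange equation is a second-order ODE). -/
def IsRegularLagrangian (Q : Set E) (L : E × E → ℝ) : Prop :=
  ∀ z ∈ Q ×ˢ (univ : Set E),
    Function.Bijective (fderiv ℝ (fun w => partialV L (z.1, w)) z.2)

/-- The Euler-Lagrange expression `∂L/∂q (q, q') - d/dt (∂L/∂v (q, q'))` at time `t` along a
curve `q` whose time derivatives are taken within `I` (one-sided at an endpoint of `I`). -/
def eulerLagrange (L : E × E → ℝ) (q : ℝ → E) (I : Set ℝ) (t : ℝ) : E →L[ℝ] ℝ :=
  partialQ L (q t, derivWithin q I t)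
    - derivWithin (fun s => partialV L (q s, derivWithin q I s)) I t

/-- `q : [0, h] → Q` is a solution curve of the Euler-Lagrange equation. -/
structure IsSolutionCurve (Q : Set E) (L : E × E → ℝ) (h : ℝ) (q : ℝ → E) : Prop where
  contDiffOn : ContDiffOn ℝ 2 q (Icc 0 h)
  mem : ∀ t ∈ Icc 0 h, q t ∈ Q
  eulerLagrange_eq : ∀ t ∈ Icc 0 h, eulerLagrange L q (Icc 0 h) t = 0

/-- The action `∫₀ʰ L(q, q') dt`. Along a solution curve `q` of the Euler-Lagrange equation this
is the value `L_d^E(q(0), q(h), h)` of the exact discrete Lagrangian. -/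
def exactDiscreteLagrangian (L : E × E → ℝ) (h : ℝ) (q : ℝ → E) : ℝ :=
  ∫ t in (0 : ℝ)..h, L (q t, derivWithin q (Icc 0 h) t)

/-- The two-point Hermite basis function `H_{n,j}` on `[0, h]`. -/
def hermiteBasis (n j : ℕ) (h t : ℝ) : ℝ :=
  t ^ j / (j ! : ℝ) * (1 - t / h) ^ n *
    ∑ s ∈ Finset.range (n - j), ((n + s - 1).choose s : ℝ) * (t / h) ^ s

/-- The two-point Hermite interpolant on `[0, h]`, a polynomial of degree at most `2n - 1`, with
prescribed derivatives `a j` at `0` and `b j` at `h`, for `j = 0, …, n - 1`. -/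
def hermiteInterpolant (n : ℕ) (h : ℝ) (a b : Fin n → E) (t : ℝ) : E :=
  ∑ j : Fin n, (hermiteBasis n j h t • a j
    + ((-1 : ℝ) ^ (j : ℕ) * hermiteBasis n j h (h - t)) • b j)

/-- `p` is a prolongation-collocation curve from `x₀` to `x₁` in time `h`: a two-point Hermite
interpolant of degree at most `2n - 1` with the boundary values `x₀`, `x₁`, along which the
Euler-Lagrange equation and its first `n - 2` prolongations (time derivatives) hold at `0`
and at `h`. -/
structure IsCollocationCurve (L : E × E → ℝ) (n : ℕ) (h : ℝ) (x₀ x₁ : E) (p : ℝ → E) : Prop where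
  hermite : ∃ a b : Fin n → E, p = hermiteInterpolant n h a b
  left : p 0 = x₀
  right : p h = x₁
  collocation_left : ∀ k ≤ n - 2, iteratedDeriv k (eulerLagrange L p univ) 0 = 0
  collocation_right : ∀ k ≤ n - 2, iteratedDeriv k (eulerLagrange L p univ) h = 0

/-- The Euler-Maclaurin quadrature formula on `[0, h]` with `m` correction terms. -/
def eulerMaclaurin (m : ℕ) (h : ℝ) (g : ℝ → ℝ) : ℝ :=
  h / 2 * (g 0 + g h)
    - ∑ l ∈ Finset.Icc 1 m, ((bernoulli (2 * l) : ℚ) : ℝ) / ((2 * l)! : ℝ) * h ^ (2 * l) *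
        (iteratedDeriv (2 * l - 1) g h - iteratedDeriv (2 * l - 1) g 0)

/-- The discrete Lagrangian obtained by applying the Euler-Maclaurin formula with `m` correction
terms to `t ↦ L(p(t), p'(t))`. The prolongation-collocation discrete Lagrangian is the case
`m = ⌊n/2⌋`, and `m = 0` is the trapezoidal rule. -/
def discreteLagrangian (L : E × E → ℝ) (m : ℕ) (h : ℝ) (p : ℝ → E) : ℝ :=
  eulerMaclaurin m h (fun t => L (p t, deriv p t))

end PCVariational

end

/-! Regularity turns the Euler-Lagrange equation into `q'' = f(q, q')`, with `f` = `accel L` of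
class `C^(2n-2)`. Along any curve the Euler-Lagrange expression is the fibre Hessian applied to
`f(p, p') - p''`. Multiplication by a smooth invertible operator preserves the order of vanishing,
so the collocation conditions say that `p'' - f(p, p')` vanishes to order `n - 2` at both ends.
Equivalently, the derivatives of `p''` there are the iterated derivatives of `f` along the
Euler-Lagrange field, evaluated at the endpoint phase points. Since `p''` has degree at most `2n -
3`, it is the two-point Hermite interpolant of order `n - 1` of these values
(`isCollocationCurve_iff`).

The curve is thus determined by its endpoint velocities `v`: interpolate, solve `p'' = g` with the
given boundary positions, and read off the new velocities. The boundary positions do not depend on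
`v`, so this map has Lipschitz constant `O(h)`. It preserves the ball of radius `R` because the
solution itself has speed at most some `R' < R`. The contraction principle gives existence and
uniqueness.

For the error, `p - q` vanishes at both ends, while `p'' - q''` is bounded by the Hermite
interpolation error `O(h^(2n-2))` plus a multiple of the endpoint velocity error. Gaining a factor
`h` and absorbing the second term gives a velocity error `O(h^(2n-1))`. The endpoint derivatives of
`L(p, p')` that enter the quadrature are functions of the endpoint phase points alone. Hence
replacing `p` by `q` in the quadrature costs `O(h^(2n))`, and the rest is the Euler-Maclaurin error
along `q`, which is `O(h^(2m+3))`. For `m = ⌊n/2⌋` this requires `2m + 2 ≤ 2n - 1` derivatives of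
the Lagrangian along `q`, which is where `n ≥ 3` enters; for `n = 2` a cruder remainder gives
`O(h^3)`.

The auxiliary lemmas from the collocation equivalence onwards write the theorem's `n` as `n + 2`. -/

namespace PCVariational

/-! ### Vector-valued polynomial curves and unisolvence -/

section PolynomialCurves

open Polynomial

variable {E : Type*} [NormedAddCommGroup E] [NormedSpace ℝ E]

/-- The space of polynomial curves in `E` of degree less than `N`. -/
def polyCurve (E : Type*) [NormedAddCommGroup E] [NormedSpace ℝ E] (N : ℕ) :
    Submodule ℝ (ℝ → E) :=
  Submodule.span ℝ {r | ∃ P : ℝ[X], P.degree < N ∧ ∃ x : E, r = fun t => P.eval t • x}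

theorem eval_smul_mem_polyCurve {N : ℕ} {P : ℝ[X]} (hP : P.degree < N) (x : E) :
    (fun t => P.eval t • x) ∈ polyCurve E N :=
  Submodule.subset_span ⟨P, hP, x, rfl⟩

theorem contDiff_of_mem_polyCurve {N : ℕ} {r : ℝ → E} (hr : r ∈ polyCurve E N)
    (k : WithTop ℕ∞) : ContDiff ℝ k r := by
  induction hr using Submodule.span_induction with
  | mem r hr =>
    obtain ⟨P, -, x, rfl⟩ := hr
    have : ContDiff ℝ k (fun t => P.eval t) := by
      simpa using (Polynomial.contDiff_aeval (𝕜 := ℝ) P k)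
    exact this.smul contDiff_const
  | zero => exact contDiff_const
  | add r s _ _ h1 h2 => exact h1.add h2
  | smul c r _ h => exact contDiff_const.smul h

theorem deriv_mem_polyCurve {N : ℕ} {r : ℝ → E} (hr : r ∈ polyCurve E (N + 1)) :
    deriv r ∈ polyCurve E N := by
  induction hr using Submodule.span_induction with
  | mem r hr =>
    obtain ⟨P, hP, x, rfl⟩ := hr
    have : deriv (fun t => P.eval t • x) = fun t => P.derivative.eval t • x := by
      ext t
      exact ((P.hasDerivAt t).smul_const x).deriv
    rw [this]
    refine eval_smul_mem_polyCurve ?_ x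
    rcases eq_or_ne P 0 with rfl | h0
    · simp
    · have h1 := degree_derivative_lt h0
      rw [degree_eq_natDegree h0] at h1 hP
      rcases eq_or_ne P.derivative 0 with h2 | h2
      · rw [h2]; simp
      · rw [degree_eq_natDegree h2] at h1 ⊢
        norm_cast at h1 hP ⊢
        omega
  | zero =>
    have : deriv (0 : ℝ → E) = 0 := by ext t; simp
    rw [this]; exact zero_mem _
  | add r s hr hs h1 h2 =>
    have : deriv (r + s) = deriv r + deriv s := by
      ext t
      exact deriv_add ((contDiff_of_mem_polyCurve hr 1).differentiable one_ne_zero t)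
        ((contDiff_of_mem_polyCurve hs 1).differentiable one_ne_zero t)
    rw [this]; exact add_mem h1 h2
  | smul c r hr h =>
    have : deriv (c • r) = c • deriv r := by
      ext t
      exact deriv_const_smul c ((contDiff_of_mem_polyCurve hr 1).differentiable one_ne_zero t)
    rw [this]; exact Submodule.smul_mem _ c h

theorem exists_hasDerivAt_mem_polyCurve {N : ℕ} {r : ℝ → E} (hr : r ∈ polyCurve E N) :
    ∃ s ∈ polyCurve E (N + 1), ∀ t, HasDerivAt s (r t) t := by
  induction hr using Submodule.span_induction with
  | mem r hr =>
    obtain ⟨P, hP, x, rfl⟩ := hr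
    have key : ∃ S : ℝ[X], S.degree < (N + 1 : ℕ) ∧ S.derivative = P := by
      refine ⟨∑ i ∈ Finset.range N, C (P.coeff i / (i + 1)) * X ^ (i + 1), ?_, ?_⟩
      · refine (degree_sum_le _ _).trans_lt ?_
        rw [Finset.sup_lt_iff (WithBot.bot_lt_coe _)]
        intro i hi
        refine (degree_C_mul_X_pow_le _ _).trans_lt ?_
        have := Finset.mem_range.1 hi
        exact_mod_cast Nat.succ_lt_succ this
      · rw [derivative_sum]
        have : ∀ i ∈ Finset.range N, derivative (C (P.coeff i / (i + 1)) * X ^ (i + 1)) =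
            C (P.coeff i) * X ^ i := by
          intro i _
          have h0 : (i : ℝ) + 1 ≠ 0 := by positivity
          rw [derivative_C_mul_X_pow]
          simp only [Nat.add_sub_cancel, Nat.cast_add, Nat.cast_one]
          rw [div_mul_cancel₀ _ h0]
        rw [Finset.sum_congr rfl this]
        ext i
        simp only [finsetSum_coeff, coeff_C_mul_X_pow, Finset.sum_ite_eq, Finset.mem_range]
        split_ifs with hi
        · rfl
        · exact (coeff_eq_zero_of_degree_lt
            (hP.trans_le (by exact_mod_cast not_lt.1 hi))).symm
    obtain ⟨S, hS, rfl⟩ := key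
    exact ⟨_, eval_smul_mem_polyCurve hS x, fun t => (S.hasDerivAt t).smul_const x⟩
  | zero => exact ⟨0, zero_mem _, fun t => hasDerivAt_const t 0⟩
  | add r s hr hs h1 h2 =>
    obtain ⟨a, ha, ha'⟩ := h1
    obtain ⟨b, hb, hb'⟩ := h2
    exact ⟨a + b, add_mem ha hb, fun t => (ha' t).add (hb' t)⟩
  | smul c r hr h =>
    obtain ⟨a, ha, ha'⟩ := h
    exact ⟨c • a, Submodule.smul_mem _ c ha, fun t => (ha' t).const_smul c⟩

/-- Pairing with functionals reduces questions about curves in `E` to real polynomials, where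
divisibility and degree arguments apply. -/
theorem exists_eval_eq_of_mem_polyCurve {N : ℕ} {r : ℝ → E} (hr : r ∈ polyCurve E N)
    (ℓ : E →L[ℝ] ℝ) : ∃ P : ℝ[X], P.degree < N ∧ ∀ t, ℓ (r t) = P.eval t := by
  induction hr using Submodule.span_induction with
  | mem r hr =>
    obtain ⟨P, hP, x, rfl⟩ := hr
    refine ⟨ℓ x • P, (degree_smul_le _ _).trans_lt hP, fun t => by simp [mul_comm]⟩
  | zero => exact ⟨0, by simp, by simp⟩
  | add r s hr hs h1 h2 =>
    obtain ⟨P, hP, hP'⟩ := h1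
    obtain ⟨S, hS, hS'⟩ := h2
    exact ⟨P + S, (degree_add_le _ _).trans_lt (max_lt hP hS), by simp [hP', hS']⟩
  | smul c r hr h =>
    obtain ⟨P, hP, hP'⟩ := h
    exact ⟨c • P, (degree_smul_le _ _).trans_lt hP, by simp [hP']⟩

theorem iteratedDeriv_polynomial_eval (P : ℝ[X]) (i : ℕ) :
    iteratedDeriv i (fun t => P.eval t) = fun t => (derivative^[i] P).eval t := by
  induction i with
  | zero => simp
  | succ i ih =>
    rw [iteratedDeriv_succ, ih, Function.iterate_succ_apply']
    ext t
    exact Polynomial.deriv _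

theorem iteratedDeriv_clm_comp {F : Type*} [NormedAddCommGroup F] [NormedSpace ℝ F]
    (ℓ : E →L[ℝ] F) {r : ℝ → E} (hr : ContDiff ℝ ⊤ r) (i : ℕ) (t : ℝ) :
    iteratedDeriv i (fun t => ℓ (r t)) t = ℓ (iteratedDeriv i r t) := by
  induction i generalizing t with
  | zero => simp
  | succ i ih =>
    rw [iteratedDeriv_succ, iteratedDeriv_succ, funext ih]
    have : HasDerivAt (iteratedDeriv i r) (deriv (iteratedDeriv i r) t) t :=
      ((hr.differentiable_iteratedDeriv i (by exact_mod_cast WithTop.coe_lt_top _)) t).hasDerivAt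
    exact (ℓ.hasFDerivAt.comp_hasDerivAt t this).deriv

theorem X_sub_C_pow_dvd_of_iterate_derivative {P : ℝ[X]} {a : ℝ} {k : ℕ}
    (h : ∀ i < k, (derivative^[i] P).eval a = 0) : (X - C a) ^ k ∣ P := by
  rcases eq_or_ne P 0 with rfl | h0
  · exact dvd_zero _
  rcases k with - | k
  · simp
  rw [← le_rootMultiplicity_iff h0]
  exact (lt_rootMultiplicity_iff_isRoot_iterate_derivative h0).2
    fun m hm => h m (Nat.lt_succ_of_le hm)

/-- Unisolvence of two-point Hermite interpolation. -/
theorem eq_zero_of_mem_polyCurve {k : ℕ} {r : ℝ → E} (hr : r ∈ polyCurve E (2 * k))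
    {h : ℝ} (hh : h ≠ 0) (h0 : ∀ i < k, iteratedDeriv i r 0 = 0)
    (h1 : ∀ i < k, iteratedDeriv i r h = 0) : r = 0 := by
  have hsm := contDiff_of_mem_polyCurve hr ⊤
  ext t
  refine (SeparatingDual.eq_zero_iff_forall_dual_eq_zero (R := ℝ) _).2 fun ℓ => ?_
  obtain ⟨P, hP, hPe⟩ := exists_eval_eq_of_mem_polyCurve hr ℓ
  have hd : ∀ i t, (derivative^[i] P).eval t = ℓ (iteratedDeriv i r t) := by
    intro i t
    rw [← iteratedDeriv_clm_comp ℓ hsm, funext hPe, iteratedDeriv_polynomial_eval]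
  have d0 := X_sub_C_pow_dvd_of_iterate_derivative (P := P) (a := 0) (k := k)
    (fun i hi => by rw [hd, h0 i hi, map_zero])
  have d1 := X_sub_C_pow_dvd_of_iterate_derivative (P := P) (a := h) (k := k)
    (fun i hi => by rw [hd, h1 i hi, map_zero])
  -- The coprime factors `X ^ k` and `(X - h) ^ k` both divide `P`, so their product, of degree
  -- `2k`, divides a polynomial of degree less than `2k`.
  have hc : IsCoprime ((X - C (0 : ℝ)) ^ k) ((X - C h) ^ k) :=
    (isCoprime_X_sub_C_of_isUnit_sub (by simpa using hh)).pow
  have := eq_zero_of_dvd_of_degree_lt (hc.mul_dvd d0 d1) (hP.trans_le (by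
    rw [degree_mul, degree_pow, degree_pow, degree_X_sub_C, degree_X_sub_C, nsmul_one, two_mul]
    exact_mod_cast le_rfl))
  rw [hPe, this, eval_zero]

end PolynomialCurves

/-! ### The Hermite basis functions -/

section HermiteBasis

open Polynomial

/-- The sum is the binomial series of `(1 - X) ^ (-(d + 1))` truncated below degree `m`. The proof
peels off one factor `1 - X` at a time, down to a geometric sum. -/
theorem X_pow_dvd_one_sub_X_pow_mul_sum (d m : ℕ) :
    X ^ m ∣ (1 - X : ℝ[X]) ^ (d + 1) *
      ∑ s ∈ Finset.range m, C (((d + 1 + s - 1).choose s : ℕ) : ℝ) * X ^ s - 1 := by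
  have step : ∀ d m : ℕ, X ^ m ∣ (1 - X : ℝ[X]) *
      ∑ s ∈ Finset.range m, C (((d + 1 + s).choose s : ℕ) : ℝ) * X ^ s -
      ∑ s ∈ Finset.range m, C (((d + s).choose s : ℕ) : ℝ) * X ^ s := by
    intro d m
    -- By Pascal's rule all coefficients below degree `m` cancel and only the top term survives. The
    -- guard at `m = 0` is needed because the truncated `m - 1` would give the coefficient `1`
    -- instead of `0`.
    refine ⟨- C (((d + m).choose (m - 1) : ℕ) : ℝ) * (if m = 0 then 0 else 1), ?_⟩
    induction m with
    | zero => simp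
    | succ m ih =>
      rw [Finset.sum_range_succ, Finset.sum_range_succ, mul_add, add_sub_add_comm, ih]
      rcases m with - | m
      · simp
      · have hp : (d + 1 + (m + 1)).choose (m + 1)
            = (d + (m + 1)).choose m + (d + (m + 1)).choose (m + 1) := by
          rw [show d + 1 + (m + 1) = d + (m + 1) + 1 by ring, Nat.choose_succ_succ]
        rw [hp]
        simp only [Nat.add_sub_cancel, Nat.succ_ne_zero, if_false]
        have e : d + (m + 1 + 1) = d + 1 + (m + 1) := by ring
        rw [e, hp]
        push_cast
        simp only [map_add]
        ring
  induction d with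
  | zero =>
    refine ⟨-1, ?_⟩
    have : ∀ s ∈ Finset.range m, C (((0 + 1 + s - 1).choose s : ℕ) : ℝ) * X ^ s = X ^ s := by
      intro s _; simp
    rw [Finset.sum_congr rfl this, zero_add, pow_one, mul_comm, mul_comm, mul_neg_geom_sum]
    ring
  | succ d ih =>
    obtain ⟨a, ha⟩ := step d m
    obtain ⟨b, hb⟩ := ih
    have e1 : ∀ s, d + 1 + 1 + s - 1 = d + 1 + s := fun s => by omega
    have e2 : ∀ s, d + 1 + s - 1 = d + s := fun s => by omega
    simp only [e1, e2] at *
    refine ⟨(1 - X) ^ (d + 1) * a + b, ?_⟩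
    linear_combination (1 - X) ^ (d + 1) * ha + hb

/-- The two-point Hermite basis function as a polynomial. -/
noncomputable def hermitePoly (n j : ℕ) (h : ℝ) : ℝ[X] :=
  C (1 / (j ! : ℝ)) * X ^ j * ((1 - C h⁻¹ * X) ^ n *
    ∑ s ∈ Finset.range (n - j), C (((n + s - 1).choose s : ℕ) : ℝ) * (C h⁻¹ * X) ^ s)

theorem eval_hermitePoly (n j : ℕ) (h t : ℝ) :
    (hermitePoly n j h).eval t = hermiteBasis n j h t := by
  simp only [hermitePoly, hermiteBasis, eval_mul, eval_C, eval_pow, eval_X, eval_sub, eval_one,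
    eval_finsetSum]
  have : h⁻¹ * t = t / h := by rw [mul_comm, div_eq_mul_inv]
  rw [this]
  ring

theorem natDegree_hermitePoly_lt {n j : ℕ} (hj : j < n) (h : ℝ) :
    (hermitePoly n j h).natDegree < 2 * n := by
  have h1 : (C h⁻¹ * X : ℝ[X]).natDegree ≤ 1 := (natDegree_C_mul_le _ _).trans natDegree_X_le
  have h2 : (1 - C h⁻¹ * X : ℝ[X]).natDegree ≤ 1 :=
    (natDegree_sub_le _ _).trans (max_le (by simp) h1)
  have h3 : (∑ s ∈ Finset.range (n - j), C (((n + s - 1).choose s : ℕ) : ℝ) *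
      (C h⁻¹ * X) ^ s : ℝ[X]).natDegree ≤ n - j - 1 := by
    refine natDegree_sum_le_of_forall_le _ _ fun s hs => ?_
    have hs' := Finset.mem_range.1 hs
    refine (natDegree_C_mul_le _ _).trans (natDegree_pow_le.trans ?_)
    calc s * _ ≤ s * 1 := Nat.mul_le_mul_left _ h1
      _ ≤ n - j - 1 := by omega
  have h4 : (hermitePoly n j h).natDegree ≤ j + (n * 1 + (n - j - 1)) := by
    refine natDegree_mul_le_of_le (natDegree_C_mul_X_pow_le _ _) ?_
    exact natDegree_mul_le_of_le (natDegree_pow_le.trans (Nat.mul_le_mul_left _ h2)) h3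
  omega

/-- The product of `(1 - t/h) ^ n` with the truncated series is `1` modulo `t ^ (n - j)`, so the
basis function is `t ^ j / j!` modulo `t ^ n`. -/
theorem iteratedDeriv_hermiteBasis_zero {n j : ℕ} (hj : j < n) (h : ℝ) {i : ℕ} (hi : i < n) :
    iteratedDeriv i (hermiteBasis n j h) 0 = if i = j then 1 else 0 := by
  have hf : hermiteBasis n j h = fun t => (hermitePoly n j h).eval t :=
    funext fun t => (eval_hermitePoly n j h t).symm
  rw [hf, iteratedDeriv_polynomial_eval]
  have hdvd : X ^ n ∣ hermitePoly n j h - C (1 / (j ! : ℝ)) * X ^ j := by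
    obtain ⟨d, rfl⟩ : ∃ d, n = d + 1 := ⟨n - 1, by omega⟩
    obtain ⟨a, ha⟩ := X_pow_dvd_one_sub_X_pow_mul_sum d (d + 1 - j)
    have hc := congrArg (compRingHom (C h⁻¹ * X)) ha
    simp only [map_sub, map_mul, map_pow, map_one, map_sum, coe_compRingHom_apply, X_comp,
      C_comp] at hc
    refine ⟨C (1 / (j ! : ℝ)) * C h⁻¹ ^ (d + 1 - j) * a.comp (C h⁻¹ * X), ?_⟩
    have e : (X : ℝ[X]) ^ (d + 1) = X ^ j * X ^ (d + 1 - j) := by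
      rw [← pow_add]; congr 1; omega
    rw [hermitePoly, e]
    rw [mul_pow] at hc
    linear_combination C (1 / (j ! : ℝ)) * X ^ j * hc
  have hcoeff := X_pow_dvd_iff.1 hdvd i hi
  rw [coeff_sub, coeff_C_mul_X_pow, sub_eq_zero] at hcoeff
  show eval 0 _ = _
  rw [← coeff_zero_eq_eval_zero, coeff_iterate_derivative, zero_add, hcoeff,
    Nat.descFactorial_self]
  split_ifs with hij
  · subst hij
    rw [nsmul_eq_mul, mul_one_div_cancel (by positivity)]
  · simp

theorem iteratedDeriv_hermiteBasis_right {n : ℕ} (j : ℕ) {h : ℝ} (hh : h ≠ 0) {i : ℕ}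
    (hi : i < n) : iteratedDeriv i (hermiteBasis n j h) h = 0 := by
  have hf : hermiteBasis n j h = fun t => (hermitePoly n j h).eval t :=
    funext fun t => (eval_hermitePoly n j h t).symm
  rw [hf, iteratedDeriv_polynomial_eval]
  have hdvd : (1 - C h⁻¹ * X) ^ n ∣ hermitePoly n j h :=
    (Dvd.intro _ rfl : _ ∣ _ * _).mul_left _
  have := pow_sub_dvd_iterate_derivative_of_pow_dvd i hdvd
  obtain ⟨a, ha⟩ := (dvd_pow_self (1 - C h⁻¹ * X : ℝ[X]) (by omega : n - i ≠ 0)).trans this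
  show eval h _ = _
  rw [ha]
  simp [hh]

theorem contDiff_hermiteBasis (n j : ℕ) (h : ℝ) (k : WithTop ℕ∞) :
    ContDiff ℝ k (hermiteBasis n j h) := by
  have hf : hermiteBasis n j h = fun t => (hermitePoly n j h).eval t :=
    funext fun t => (eval_hermitePoly n j h t).symm
  rw [hf]
  simpa using (Polynomial.contDiff_aeval (𝕜 := ℝ) (hermitePoly n j h) k)

/-- The factor `h ^ j` is the natural scaling of the basis function attached to a `j`-th derivative;
it produces the weights in the stability estimate. -/
theorem abs_hermiteBasis_le (n j : ℕ) {h t : ℝ} (hh : 0 < h) (ht : t ∈ Icc 0 h) :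
    |hermiteBasis n j h t| ≤ (∑ s ∈ Finset.range n, ((n + s - 1).choose s : ℝ)) * h ^ j := by
  have h1 : 0 ≤ t / h := div_nonneg ht.1 hh.le
  have h2 : t / h ≤ 1 := (div_le_one hh).2 ht.2
  have hs : ∑ s ∈ Finset.range (n - j), ((n + s - 1).choose s : ℝ) * (t / h) ^ s ≤
      ∑ s ∈ Finset.range n, ((n + s - 1).choose s : ℝ) := by
    calc _ ≤ ∑ s ∈ Finset.range (n - j), ((n + s - 1).choose s : ℝ) :=
          Finset.sum_le_sum fun s _ => mul_le_of_le_one_right (by positivity) (pow_le_one₀ h1 h2)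
      _ ≤ _ := Finset.sum_le_sum_of_subset_of_nonneg
          (Finset.range_mono (Nat.sub_le _ _)) fun _ _ _ => by positivity
  have hf : t ^ j / (j ! : ℝ) ≤ h ^ j :=
    (div_le_self (pow_nonneg ht.1 _) (by exact_mod_cast Nat.one_le_iff_ne_zero.2 j.factorial_ne_zero)).trans
      (pow_le_pow_left₀ ht.1 ht.2 _)
  have hp : (1 - t / h) ^ n ≤ 1 := pow_le_one₀ (by linarith) (by linarith)
  have hp0 : 0 ≤ (1 - t / h) ^ n := pow_nonneg (by linarith) _
  have hf0 : 0 ≤ t ^ j / (j ! : ℝ) := div_nonneg (pow_nonneg ht.1 _) (by positivity)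
  have hs0 : 0 ≤ ∑ s ∈ Finset.range (n - j), ((n + s - 1).choose s : ℝ) * (t / h) ^ s :=
    Finset.sum_nonneg fun s _ => by positivity
  rw [hermiteBasis, abs_of_nonneg (by positivity)]
  calc _ ≤ h ^ j * 1 * ∑ s ∈ Finset.range n, ((n + s - 1).choose s : ℝ) := by gcongr
    _ = _ := by ring

end HermiteBasis

/-! ### Two-point Hermite interpolation: reproduction and stability -/

section HermiteInterpolant

variable {E : Type*} [NormedAddCommGroup E] [NormedSpace ℝ E]

open Polynomial in
theorem hermiteInterpolant_mem_polyCurve (n : ℕ) (h : ℝ) (a b : Fin n → E) :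
    hermiteInterpolant n h a b ∈ polyCurve E (2 * n) := by
  have : hermiteInterpolant n h a b = ∑ j : Fin n,
      ((fun t => (hermitePoly n j h).eval t • a j) +
        fun t => (C ((-1) ^ (j : ℕ)) * (hermitePoly n j h).comp (C h - X)).eval t • b j) := by
    ext t
    simp [hermiteInterpolant, eval_hermitePoly]
  have h1 := fun j : Fin n => natDegree_hermitePoly_lt j.2 h
  rw [this]
  refine sum_mem fun j _ => add_mem
    (eval_smul_mem_polyCurve (degree_le_natDegree.trans_lt (by exact_mod_cast h1 j)) _) (eval_smul_mem_polyCurve ?_ _)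
  refine degree_le_natDegree.trans_lt ?_
  norm_cast
  refine lt_of_le_of_lt ((natDegree_C_mul_le _ _).trans (natDegree_comp_le.trans ?_)) (h1 j)
  calc _ ≤ (hermitePoly n j h).natDegree * 1 := Nat.mul_le_mul_left _
        ((natDegree_sub_le _ _).trans (by simp))
    _ = _ := mul_one _

theorem iteratedDeriv_hermiteInterpolant (n : ℕ) (h : ℝ) (a b : Fin n → E) (i : ℕ) (t : ℝ) :
    iteratedDeriv i (hermiteInterpolant n h a b) t =
      ∑ j : Fin n, (iteratedDeriv i (hermiteBasis n j h) t • a j +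
        ((-1 : ℝ) ^ (j : ℕ) * ((-1) ^ i * iteratedDeriv i (hermiteBasis n j h) (h - t))) • b j) := by
  have hA : ∀ j, ContDiff ℝ i (hermiteBasis n j h) := fun j => contDiff_hermiteBasis n j h i
  have hB : ∀ j, ContDiff ℝ i (fun t => hermiteBasis n j h (h - t)) := fun j =>
    (hA j).comp (contDiff_const.sub contDiff_id)
  unfold hermiteInterpolant
  have hA' : ∀ j : Fin n, ContDiff ℝ i (fun t => hermiteBasis n j h t • a j) := fun j =>
    (hA j).smul contDiff_const
  have hB' : ∀ j : Fin n,
      ContDiff ℝ i (fun t => ((-1 : ℝ) ^ (j : ℕ) * hermiteBasis n j h (h - t)) • b j) := fun j =>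
    (contDiff_const.mul (hB j)).smul contDiff_const
  rw [iteratedDeriv_fun_sum fun j _ => ((hA' j).add (hB' j)).contDiffAt]
  refine Finset.sum_congr rfl fun j _ => ?_
  rw [iteratedDeriv_fun_add (hA' j).contDiffAt (hB' j).contDiffAt,
    iteratedDeriv_smul_const (hA j).contDiffAt,
    iteratedDeriv_smul_const (contDiff_const.mul (hB j)).contDiffAt,
    iteratedDeriv_const_mul _ (hB j).contDiffAt, iteratedDeriv_comp_const_sub]
  simp

theorem iteratedDeriv_hermiteInterpolant_zero {n : ℕ} {h : ℝ} (hh : h ≠ 0) (a b : Fin n → E)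
    (i : Fin n) : iteratedDeriv i (hermiteInterpolant n h a b) 0 = a i := by
  rw [iteratedDeriv_hermiteInterpolant, Finset.sum_eq_single i]
  · rw [iteratedDeriv_hermiteBasis_zero i.2 h i.2, sub_zero,
      iteratedDeriv_hermiteBasis_right i hh i.2]
    simp
  · intro j _ hj
    rw [iteratedDeriv_hermiteBasis_zero j.2 h i.2, sub_zero,
      iteratedDeriv_hermiteBasis_right j hh i.2, if_neg (fun e => hj (Fin.ext e.symm))]
    simp
  · simp

theorem iteratedDeriv_hermiteInterpolant_right {n : ℕ} {h : ℝ} (hh : h ≠ 0) (a b : Fin n → E)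
    (i : Fin n) : iteratedDeriv i (hermiteInterpolant n h a b) h = b i := by
  rw [iteratedDeriv_hermiteInterpolant, Finset.sum_eq_single i]
  · rw [sub_self, iteratedDeriv_hermiteBasis_zero i.2 h i.2,
      iteratedDeriv_hermiteBasis_right i hh i.2]
    simp [← mul_pow]
  · intro j _ hj
    rw [sub_self, iteratedDeriv_hermiteBasis_zero j.2 h i.2,
      iteratedDeriv_hermiteBasis_right j hh i.2, if_neg (fun e => hj (Fin.ext e.symm))]
    simp
  · simp

/-- A polynomial curve of degree less than `2n` is the two-point Hermite interpolant of its
own derivatives. -/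
theorem eq_hermiteInterpolant_of_mem_polyCurve {n : ℕ} {h : ℝ} (hh : h ≠ 0) {r : ℝ → E}
    (hr : r ∈ polyCurve E (2 * n)) :
    r = hermiteInterpolant n h (fun i => iteratedDeriv i r 0) (fun i => iteratedDeriv i r h) := by
  have hH := hermiteInterpolant_mem_polyCurve n h (fun i => iteratedDeriv i r 0)
    (fun i => iteratedDeriv i r h)
  rw [← sub_eq_zero]
  refine eq_zero_of_mem_polyCurve (sub_mem hr hH) hh (fun i hi => ?_) (fun i hi => ?_)
  · rw [iteratedDeriv_sub (contDiff_of_mem_polyCurve hr i).contDiffAt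
      (contDiff_of_mem_polyCurve hH i).contDiffAt,
      iteratedDeriv_hermiteInterpolant_zero hh _ _ ⟨i, hi⟩, sub_self]
  · rw [iteratedDeriv_sub (contDiff_of_mem_polyCurve hr i).contDiffAt
      (contDiff_of_mem_polyCurve hH i).contDiffAt,
      iteratedDeriv_hermiteInterpolant_right hh _ _ ⟨i, hi⟩, sub_self]

theorem hermiteInterpolant_sub (n : ℕ) (h : ℝ) (a b a' b' : Fin n → E) (t : ℝ) :
    hermiteInterpolant n h a b t - hermiteInterpolant n h a' b' t =
      hermiteInterpolant n h (a - a') (b - b') t := by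
  simp only [hermiteInterpolant, ← Finset.sum_sub_distrib, Pi.sub_apply, smul_sub]
  exact Finset.sum_congr rfl fun _ _ => by abel

/-- Stability of two-point Hermite interpolation. -/
theorem exists_norm_hermiteInterpolant_le (n : ℕ) :
    ∃ S : ℝ, 0 ≤ S ∧ ∀ (h : ℝ), 0 < h → ∀ (a b : Fin n → E) (B : ℝ),
      (∀ i : Fin n, h ^ (i : ℕ) * ‖a i‖ ≤ B) → (∀ i : Fin n, h ^ (i : ℕ) * ‖b i‖ ≤ B) →
      ∀ t ∈ Icc 0 h, ‖hermiteInterpolant n h a b t‖ ≤ S * B := by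
  set c : ℝ := ∑ s ∈ Finset.range n, ((n + s - 1).choose s : ℝ)
  have hc : 0 ≤ c := Finset.sum_nonneg fun _ _ => by positivity
  refine ⟨n * (2 * c), by positivity, fun h hh a b B ha hb t ht => ?_⟩
  have ht' : h - t ∈ Icc 0 h := ⟨by linarith [ht.2], by linarith [ht.1]⟩
  calc _ ≤ ∑ _j : Fin n, (2 * c * B) := by
        refine norm_sum_le_of_le _ fun j _ => ?_
        have h1 := abs_hermiteBasis_le n j hh ht
        have h2 := abs_hermiteBasis_le n j hh ht'
        calc _ ≤ ‖hermiteBasis n j h t • a j‖ +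
              ‖((-1 : ℝ) ^ (j : ℕ) * hermiteBasis n j h (h - t)) • b j‖ := norm_add_le _ _
          _ ≤ c * h ^ (j : ℕ) * ‖a j‖ + c * h ^ (j : ℕ) * ‖b j‖ := by
              rw [norm_smul, norm_smul, norm_mul, norm_pow, norm_neg, norm_one, one_pow, one_mul]
              gcongr <;> assumption
          _ = c * (h ^ (j : ℕ) * ‖a j‖) + c * (h ^ (j : ℕ) * ‖b j‖) := by ring
          _ ≤ c * B + c * B := by gcongr; exacts [ha j, hb j]
          _ = 2 * c * B := by ring
    _ = _ := by simp; ring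

end HermiteInterpolant

/-! ### Taylor estimates for chains of one-sided derivatives -/

section DerivChain

variable {F : Type*} [NormedAddCommGroup F] [NormedSpace ℝ F]

/-- `γ 0, …, γ N` are continuous on `[0, h]` and each is the derivative of its predecessor. -/
structure IsDerivChain (N : ℕ) (h : ℝ) (γ : ℕ → ℝ → F) : Prop where
  hasDerivWithinAt : ∀ i < N, ∀ t ∈ Icc 0 h, HasDerivWithinAt (γ i) (γ (i + 1) t) (Icc 0 h) t
  continuousOn_last : ContinuousOn (γ N) (Icc 0 h)

theorem IsDerivChain.continuousOn {N : ℕ} {h : ℝ} {γ : ℕ → ℝ → F} (hγ : IsDerivChain N h γ)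
    {i : ℕ} (hi : i ≤ N) : ContinuousOn (γ i) (Icc 0 h) := by
  rcases hi.lt_or_eq with hi | rfl
  · exact fun t ht => (hγ.hasDerivWithinAt i hi t ht).continuousWithinAt
  · exact hγ.continuousOn_last

theorem IsDerivChain.mono {M N : ℕ} {h : ℝ} {γ : ℕ → ℝ → F} (hγ : IsDerivChain N h γ)
    (hM : M ≤ N) : IsDerivChain M h γ :=
  ⟨fun i hi => hγ.hasDerivWithinAt i (hi.trans_le hM), hγ.continuousOn hM⟩

theorem IsDerivChain.norm_sub_le {N : ℕ} {h : ℝ} {γ : ℕ → ℝ → F} (hγ : IsDerivChain N h γ)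
    {i : ℕ} (hi : i < N) {B : ℝ} (hB : ∀ t ∈ Icc 0 h, ‖γ (i + 1) t‖ ≤ B) {s t : ℝ}
    (hs : s ∈ Icc 0 h) (ht : t ∈ Icc 0 h) : ‖γ i t - γ i s‖ ≤ B * h := by
  have h1 := (convex_Icc (0 : ℝ) h).norm_image_sub_le_of_norm_hasDerivWithin_le
    (hγ.hasDerivWithinAt i hi) hB hs ht
  refine h1.trans (mul_le_mul_of_nonneg_left ?_ ((norm_nonneg _).trans (hB s hs)))
  rw [Real.norm_eq_abs, abs_le]
  constructor <;> linarith [hs.1, hs.2, ht.1, ht.2]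

/-- Descending from the top derivative, each application of the mean value inequality from `0` gains
one factor `h`: this is Taylor's remainder estimate. -/
theorem IsDerivChain.norm_le_of_zero {N : ℕ} {h : ℝ} (hh : 0 ≤ h) {γ : ℕ → ℝ → F}
    (hγ : IsDerivChain N h γ) (h0 : ∀ i < N, γ i 0 = 0) {B : ℝ}
    (hB : ∀ t ∈ Icc 0 h, ‖γ N t‖ ≤ B) {k : ℕ} (hk : k ≤ N) :
    ∀ t ∈ Icc 0 h, ‖γ (N - k) t‖ ≤ B * h ^ k := by
  induction k with
  | zero => simpa using hB
  | succ k ih =>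
    intro t ht
    have e : N - (k + 1) + 1 = N - k := by omega
    have := hγ.norm_sub_le (i := N - (k + 1)) (by omega) (by rw [e]; exact ih (by omega))
      (left_mem_Icc.2 hh) ht
    rw [h0 _ (by omega), sub_zero] at this
    rwa [pow_succ, ← mul_assoc]

/-- First order Taylor estimate, with the derivative taken at an arbitrary point. -/
theorem norm_sub_sub_smul_le {h : ℝ} (hh : 0 ≤ h) {u u₁ u₂ : ℝ → F}
    (hu : ∀ t ∈ Icc 0 h, HasDerivWithinAt u (u₁ t) (Icc 0 h) t)
    (hu₁ : ∀ t ∈ Icc 0 h, HasDerivWithinAt u₁ (u₂ t) (Icc 0 h) t) {B : ℝ}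
    (hB : ∀ t ∈ Icc 0 h, ‖u₂ t‖ ≤ B) {s : ℝ} (hs : s ∈ Icc 0 h) :
    ‖u h - u 0 - h • u₁ s‖ ≤ B * h * h := by
  have h0 : ∀ t ∈ Icc 0 h, ‖u₁ t - u₁ s‖ ≤ B * h := fun t ht => by
    refine ((convex_Icc (0 : ℝ) h).norm_image_sub_le_of_norm_hasDerivWithin_le hu₁ hB hs ht).trans
      (mul_le_mul_of_nonneg_left ?_ ((norm_nonneg _).trans (hB s hs)))
    rw [Real.norm_eq_abs, abs_le]
    constructor <;> linarith [hs.1, hs.2, ht.1, ht.2]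
  have h1 : ∀ t ∈ Icc 0 h, HasDerivWithinAt (fun t => u t - t • u₁ s) (u₁ t - u₁ s)
      (Icc 0 h) t := fun t ht => by
    have := (hu t ht).sub ((hasDerivWithinAt_id t _).smul_const (u₁ s))
    rwa [one_smul] at this
  have h2 := norm_image_sub_le_of_norm_deriv_le_segment' h1
    (fun t ht => h0 t (Ico_subset_Icc_self ht)) h (right_mem_Icc.2 hh)
  simp only [zero_smul, sub_zero] at h2
  rwa [sub_right_comm]

/-- With vanishing boundary values the chord slope is zero, so the derivative is controlled by the
second derivative times `h`. This factor `h` yields both the contraction and the extra order of the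
velocity error. -/
theorem norm_deriv_le_of_eq_zero {h : ℝ} (hh : 0 < h) {u u₁ u₂ : ℝ → F}
    (hu : ∀ t ∈ Icc 0 h, HasDerivWithinAt u (u₁ t) (Icc 0 h) t)
    (hu₁ : ∀ t ∈ Icc 0 h, HasDerivWithinAt u₁ (u₂ t) (Icc 0 h) t) {B : ℝ}
    (hB : ∀ t ∈ Icc 0 h, ‖u₂ t‖ ≤ B) (h0 : u 0 = 0) (h1 : u h = 0) {s : ℝ} (hs : s ∈ Icc 0 h) :
    ‖u₁ s‖ ≤ B * h := by
  have := norm_sub_sub_smul_le hh.le hu hu₁ hB hs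
  rw [h0, h1, sub_zero, zero_sub, norm_neg, norm_smul, Real.norm_eq_abs, abs_of_pos hh,
    mul_comm] at this
  exact le_of_mul_le_mul_right this hh

end DerivChain

/-! ### The Euler-Maclaurin formula, its remainder and its stability -/

section EulerMaclaurin

/-- The Bernoulli polynomial of `[0, h]`, normalized to be an iterated antiderivative of `1`. -/
noncomputable def scaledBernoulli (k : ℕ) (h t : ℝ) : ℝ :=
  h ^ k / (k ! : ℝ) * bernoulliFun k (t / h)

theorem hasDerivAt_scaledBernoulli (k : ℕ) {h : ℝ} (hh : h ≠ 0) (t : ℝ) :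
    HasDerivAt (scaledBernoulli (k + 1) h) (scaledBernoulli k h t) t := by
  have h1 : HasDerivAt (fun t => t / h) (1 / h) t := (hasDerivAt_id t).div_const h
  have h2 := ((hasDerivAt_bernoulliFun (k + 1) (t / h)).comp t h1).const_mul
    (h ^ (k + 1) / ((k + 1)! : ℝ))
  convert! h2 using 1
  rw [scaledBernoulli, Nat.factorial_succ]
  have : (k ! : ℝ) ≠ 0 := by positivity
  have : ((k : ℝ) + 1) ≠ 0 := by positivity
  push_cast [Nat.add_sub_cancel]
  field_simp
  ring

theorem scaledBernoulli_zero_right (k : ℕ) (h : ℝ) :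
    scaledBernoulli k h 0 = h ^ k / (k ! : ℝ) * (bernoulli k : ℝ) := by
  rw [scaledBernoulli, zero_div, bernoulliFun_eval_zero]

/-- The index `1` is excluded because the first Bernoulli polynomial is `-1/2` at `0` and `1/2` at
`1`; this asymmetry is what produces the trapezoidal term. -/
theorem scaledBernoulli_self {k : ℕ} (hk : k ≠ 1) {h : ℝ} (hh : h ≠ 0) :
    scaledBernoulli k h h = h ^ k / (k ! : ℝ) * (bernoulli k : ℝ) := by
  rw [scaledBernoulli, div_self hh, bernoulliFun_endpoints_eq_of_ne_one hk, bernoulliFun_eval_zero]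

theorem continuous_scaledBernoulli (k : ℕ) (h : ℝ) : Continuous (scaledBernoulli k h) :=
  continuous_const.mul ((continuous_bernoulliFun k).comp (continuous_id.div_const h))

theorem exists_abs_scaledBernoulli_le (k : ℕ) :
    ∃ c : ℝ, 0 ≤ c ∧ ∀ h : ℝ, 0 < h → ∀ t ∈ Icc 0 h, |scaledBernoulli k h t| ≤ c * h ^ k := by
  obtain ⟨c, hc⟩ := (isCompact_Icc (a := (0 : ℝ)) (b := 1)).exists_bound_of_continuousOn
    (continuous_bernoulliFun k).continuousOn
  refine ⟨|c|, abs_nonneg _, fun h hh t ht => ?_⟩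
  have h1 := (hc (t / h) ⟨div_nonneg ht.1 hh.le, (div_le_one hh).2 ht.2⟩).trans (le_abs_self c)
  rw [Real.norm_eq_abs] at h1
  rw [scaledBernoulli, abs_mul, abs_of_nonneg (by positivity), mul_comm]
  gcongr
  exact div_le_self (by positivity) (by exact_mod_cast Nat.one_le_iff_ne_zero.2 k.factorial_ne_zero)

/-- The Euler-Maclaurin quadrature formula in terms of given derivatives `γ i` of `γ 0`. -/
noncomputable def eulerMaclaurinChain (m : ℕ) (h : ℝ) (γ : ℕ → ℝ → ℝ) : ℝ :=
  h / 2 * (γ 0 0 + γ 0 h)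
    - ∑ l ∈ Finset.Icc 1 m, ((bernoulli (2 * l) : ℚ) : ℝ) / ((2 * l)! : ℝ) * h ^ (2 * l) *
        (γ (2 * l - 1) h - γ (2 * l - 1) 0)

theorem eulerMaclaurinChain_succ (m : ℕ) (h : ℝ) (γ : ℕ → ℝ → ℝ) :
    eulerMaclaurinChain (m + 1) h γ = eulerMaclaurinChain m h γ -
      ((bernoulli (2 * (m + 1)) : ℚ) : ℝ) / ((2 * (m + 1))! : ℝ) * h ^ (2 * (m + 1)) *
        (γ (2 * m + 1) h - γ (2 * m + 1) 0) := by
  rw [eulerMaclaurinChain, eulerMaclaurinChain, Finset.sum_Icc_succ_top (by omega),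
    show 2 * (m + 1) - 1 = 2 * m + 1 by omega]
  ring

theorem IsDerivChain.integral_scaledBernoulli_mul {N : ℕ} {h : ℝ} (hh : 0 < h) {γ : ℕ → ℝ → ℝ}
    (hγ : IsDerivChain N h γ) {i : ℕ} (hi : i < N) :
    ∫ t in (0 : ℝ)..h, scaledBernoulli i h t * γ i t =
      (scaledBernoulli (i + 1) h h * γ i h - scaledBernoulli (i + 1) h 0 * γ i 0) -
        ∫ t in (0 : ℝ)..h, scaledBernoulli (i + 1) h t * γ (i + 1) t := by
  have hI : uIcc 0 h = Icc 0 h := uIcc_of_le hh.le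
  have := intervalIntegral.integral_mul_deriv_eq_deriv_mul_of_hasDerivWithinAt
    (a := 0) (b := h) (u := scaledBernoulli (i + 1) h) (u' := scaledBernoulli i h) (v := γ i)
    (v' := γ (i + 1)) (fun t _ => (hasDerivAt_scaledBernoulli i hh.ne' t).hasDerivWithinAt)
    (by rw [hI]; exact hγ.hasDerivWithinAt i hi)
    ((continuous_scaledBernoulli i h).intervalIntegrable _ _)
    (ContinuousOn.intervalIntegrable (by rw [hI]; exact hγ.continuousOn hi))
  rw [this]
  ring

/-- The Euler-Maclaurin formula with integral remainder. -/
theorem IsDerivChain.integral_eq_eulerMaclaurinChain_add {m : ℕ} {h : ℝ} (hh : 0 < h)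
    {γ : ℕ → ℝ → ℝ} (hγ : IsDerivChain (2 * (m + 1)) h γ) :
    ∫ t in (0 : ℝ)..h, γ 0 t = eulerMaclaurinChain (m + 1) h γ +
      ∫ t in (0 : ℝ)..h, scaledBernoulli (2 * (m + 1)) h t * γ (2 * (m + 1)) t := by
  induction m with
  | zero =>
    -- Two integrations by parts: the boundary term of index `1` is the trapezoidal rule, that of
    -- index `2` the first correction.
    have e0 : ∀ t, γ 0 t = scaledBernoulli 0 h t * γ 0 t := by simp [scaledBernoulli]
    rw [intervalIntegral.integral_congr (fun t _ => e0 t),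
      hγ.integral_scaledBernoulli_mul hh (i := 0) (by norm_num), zero_add,
      hγ.integral_scaledBernoulli_mul hh (i := 1) (by norm_num),
      scaledBernoulli_zero_right, scaledBernoulli_zero_right,
      scaledBernoulli_self (by norm_num : 1 + 1 ≠ 1) hh.ne', eulerMaclaurinChain_succ]
    have e1 : scaledBernoulli 1 h h = h / 2 := by
      rw [scaledBernoulli, div_self hh.ne', bernoulliFun_one]; norm_num; ring
    rw [e1, bernoulli_one]
    simp only [eulerMaclaurinChain, Nat.factorial]
    norm_num
    ring
  | succ m ih =>
    -- Two more integrations by parts: the boundary term of odd index vanishes with its Bernoulli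
    -- number, the even one is the next correction.
    rw [ih (hγ.mono (by omega)), hγ.integral_scaledBernoulli_mul hh (by omega),
      hγ.integral_scaledBernoulli_mul hh (by omega),
      scaledBernoulli_zero_right, scaledBernoulli_zero_right,
      scaledBernoulli_self (by omega) hh.ne', scaledBernoulli_self (by omega) hh.ne',
      bernoulli_eq_zero_of_odd ⟨m + 1, by ring⟩ (by omega), eulerMaclaurinChain_succ (m + 1)]
    simp only [show 2 * (m + 1) + 1 + 1 = 2 * (m + 1 + 1) by ring]
    push_cast
    ring

/-- The kernel has size `h ^ (2 * m + 2)` and is integrated over length `h`. The exponent is not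
optimal for `m + 1` corrections, but only `2 * (m + 1)` derivatives are needed. With `m = 0` this
serves one correction term for cubic interpolation, where only three derivatives of the Lagrangian
along a solution are available. -/
theorem exists_abs_eulerMaclaurinChain_succ_sub_integral_le (m : ℕ) :
    ∃ c : ℝ, 0 ≤ c ∧ ∀ (h : ℝ), 0 < h → ∀ (γ : ℕ → ℝ → ℝ) (B : ℝ),
      IsDerivChain (2 * (m + 1)) h γ → (∀ t ∈ Icc 0 h, |γ (2 * (m + 1)) t| ≤ B) →
      |eulerMaclaurinChain (m + 1) h γ - ∫ t in (0 : ℝ)..h, γ 0 t| ≤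
        c * B * h ^ (2 * m + 3) := by
  obtain ⟨c, hc0, hc⟩ := exists_abs_scaledBernoulli_le (2 * (m + 1))
  refine ⟨c, hc0, fun h hh γ B hγ hB => ?_⟩
  rw [hγ.integral_eq_eulerMaclaurinChain_add hh, sub_add_cancel_left, abs_neg]
  have hI : uIoc 0 h = Ioc 0 h := uIoc_of_le hh.le
  have := intervalIntegral.norm_integral_le_of_norm_le_const (a := 0) (b := h)
    (C := c * h ^ (2 * (m + 1)) * B)
    (f := fun t => scaledBernoulli (2 * (m + 1)) h t * γ (2 * (m + 1)) t) (fun t ht => by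
      rw [hI] at ht
      have ht' := Ioc_subset_Icc_self ht
      rw [norm_mul]
      exact mul_le_mul (hc h hh t ht') (hB t ht') (norm_nonneg _) (by positivity))
  rw [Real.norm_eq_abs, sub_zero, abs_of_pos hh] at this
  refine this.trans (le_of_eq ?_)
  ring

/-- The error of the Euler-Maclaurin formula with `m` correction terms is `O(h ^ (2m + 3))`. -/
theorem exists_abs_eulerMaclaurinChain_sub_integral_le (m : ℕ) :
    ∃ c : ℝ, 0 ≤ c ∧ ∀ (h : ℝ), 0 < h → ∀ (γ : ℕ → ℝ → ℝ) (B : ℝ),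
      IsDerivChain (2 * (m + 1)) h γ → (∀ t ∈ Icc 0 h, |γ (2 * (m + 1)) t| ≤ B) →
      |eulerMaclaurinChain m h γ - ∫ t in (0 : ℝ)..h, γ 0 t| ≤ c * B * h ^ (2 * m + 3) := by
  obtain ⟨c, hc0, hc⟩ := exists_abs_eulerMaclaurinChain_succ_sub_integral_le m
  set b : ℝ := ((bernoulli (2 * (m + 1)) : ℚ) : ℝ) / ((2 * (m + 1))! : ℝ)
  refine ⟨c + |b|, by positivity, fun h hh γ B hγ hB => ?_⟩
  have h1 := hc h hh γ B hγ hB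
  rw [eulerMaclaurinChain_succ] at h1
  -- The last correction term may be dropped: the difference of the endpoint values of `γ (2 * m +
  -- 1)` gains one more factor `h`, so the term has the order of the remainder.
  have h2 : |b * h ^ (2 * (m + 1)) * (γ (2 * m + 1) h - γ (2 * m + 1) 0)| ≤
      |b| * h ^ (2 * (m + 1)) * (B * h) := by
    rw [abs_mul, abs_mul, abs_of_pos (pow_pos hh _)]
    gcongr
    exact hγ.norm_sub_le (i := 2 * m + 1) (by omega) hB (left_mem_Icc.2 hh.le)
      (right_mem_Icc.2 hh.le)
  have h3 := abs_add_le (eulerMaclaurinChain m h γ -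
    b * h ^ (2 * (m + 1)) * (γ (2 * m + 1) h - γ (2 * m + 1) 0) - ∫ t in (0 : ℝ)..h, γ 0 t)
    (b * h ^ (2 * (m + 1)) * (γ (2 * m + 1) h - γ (2 * m + 1) 0))
  calc _ ≤ _ := by rw [show eulerMaclaurinChain m h γ - ∫ t in (0 : ℝ)..h, γ 0 t =
        eulerMaclaurinChain m h γ -
        b * h ^ (2 * (m + 1)) * (γ (2 * m + 1) h - γ (2 * m + 1) 0) - (∫ t in (0 : ℝ)..h, γ 0 t) +
        b * h ^ (2 * (m + 1)) * (γ (2 * m + 1) h - γ (2 * m + 1) 0) by ring]; exact h3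
    _ ≤ _ := add_le_add h1 h2
    _ = _ := by ring

/-- The Euler-Maclaurin formula depends only on the endpoint values of the derivatives
of order at most `2m - 1`, in a Lipschitz way. -/
theorem exists_abs_eulerMaclaurinChain_sub_le (m : ℕ) :
    ∃ c : ℝ, 0 ≤ c ∧ ∀ (h : ℝ), 0 < h → h ≤ 1 → ∀ (γ δ : ℕ → ℝ → ℝ) (B : ℝ),
      (∀ i ≤ 2 * m - 1, |γ i 0 - δ i 0| ≤ B) → (∀ i ≤ 2 * m - 1, |γ i h - δ i h| ≤ B) →
      |eulerMaclaurinChain m h γ - eulerMaclaurinChain m h δ| ≤ c * B * h := by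
  refine ⟨1 + ∑ l ∈ Finset.Icc 1 m,
    |((bernoulli (2 * l) : ℚ) : ℝ) / ((2 * l)! : ℝ)| * 2, by positivity,
    fun h hh hh1 γ δ B h0 h1 => ?_⟩
  -- With truncated subtraction `0 ≤ 2 * m - 1` holds even for `m = 0`, so the hypotheses always
  -- cover the values of `γ 0` used by the trapezoidal rule.
  have hB : 0 ≤ B := (abs_nonneg _).trans (h0 0 (Nat.zero_le _))
  have e : eulerMaclaurinChain m h γ - eulerMaclaurinChain m h δ =
      h / 2 * ((γ 0 0 - δ 0 0) + (γ 0 h - δ 0 h)) - ∑ l ∈ Finset.Icc 1 m,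
        ((bernoulli (2 * l) : ℚ) : ℝ) / ((2 * l)! : ℝ) * h ^ (2 * l) *
        ((γ (2 * l - 1) h - δ (2 * l - 1) h) - (γ (2 * l - 1) 0 - δ (2 * l - 1) 0)) := by
    rw [eulerMaclaurinChain, eulerMaclaurinChain, sub_sub_sub_comm, ← Finset.sum_sub_distrib]
    congr 1
    · ring
    · exact Finset.sum_congr rfl fun _ _ => by ring
  rw [e, add_mul, add_mul, Finset.sum_mul, Finset.sum_mul]
  refine (abs_sub _ _).trans (add_le_add ?_ ?_)
  · rw [abs_mul, abs_of_pos (by positivity)]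
    calc _ ≤ h / 2 * (B + B) := by
          gcongr
          exact (abs_add_le _ _).trans (add_le_add (h0 0 (Nat.zero_le _)) (h1 0 (Nat.zero_le _)))
      _ = _ := by ring
  · refine (Finset.abs_sum_le_sum_abs _ _).trans (Finset.sum_le_sum fun l hl => ?_)
    have hl' := Finset.mem_Icc.1 hl
    rw [abs_mul, abs_mul, abs_of_pos (pow_pos hh (2 * l))]
    calc _ ≤ |((bernoulli (2 * l) : ℚ) : ℝ) / ((2 * l)! : ℝ)| * h * (B + B) := by
          gcongr
          · exact pow_le_of_le_one hh.le hh1 (by omega)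
          · exact (abs_sub _ _).trans (add_le_add (h1 _ (by omega)) (h0 _ (by omega)))
      _ = _ := by ring

end EulerMaclaurin

/-! ### Derivatives along a vector field and vanishing to finite order -/

section LieDerivative

open Filter Topology

variable {V F G : Type*} [NormedAddCommGroup V] [NormedSpace ℝ V] [NormedAddCommGroup F]
  [NormedSpace ℝ F] [NormedAddCommGroup G] [NormedSpace ℝ G]

/-- The derivative of the vector-valued function `G` along the vector field `X`. -/
noncomputable def lieDeriv (X : V → V) (G : V → F) (z : V) : F :=
  fderiv ℝ G z (X z)

/-- The iterated derivative of the vector-valued function `G` along the vector field `X`. -/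
noncomputable def iterLieDeriv (X : V → V) (i : ℕ) (G : V → F) : V → F :=
  (lieDeriv X)^[i] G

theorem iterLieDeriv_zero (X : V → V) (G : V → F) : iterLieDeriv X 0 G = G := rfl

theorem iterLieDeriv_succ (X : V → V) (i : ℕ) (G : V → F) :
    iterLieDeriv X (i + 1) G = lieDeriv X (iterLieDeriv X i G) :=
  Function.iterate_succ_apply' _ _ _

theorem iterLieDeriv_succ' (X : V → V) (i : ℕ) (G : V → F) :
    iterLieDeriv X (i + 1) G = iterLieDeriv X i (lieDeriv X G) :=
  Function.iterate_succ_apply _ _ _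

theorem contDiffOn_lieDeriv {Ω : Set V} (hΩ : IsOpen Ω) {X : V → V} {G : V → F} {k : ℕ}
    (hG : ContDiffOn ℝ (k + 1 : ℕ) G Ω) (hX : ContDiffOn ℝ k X Ω) :
    ContDiffOn ℝ k (lieDeriv X G) Ω :=
  (hG.fderiv_of_isOpen hΩ (by norm_cast)).clm_apply hX

/-- The first Lie derivative uses the field without differentiating it, so `G` may be one order
smoother than `X`; hence `N ≤ M + 1`. -/
theorem contDiffOn_iterLieDeriv {Ω : Set V} (hΩ : IsOpen Ω) {X : V → V} {G : V → F} {N M : ℕ}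
    (hG : ContDiffOn ℝ N G Ω) (hX : ContDiffOn ℝ M X Ω) (hNM : N ≤ M + 1) {i : ℕ} (hi : i ≤ N) :
    ContDiffOn ℝ (N - i : ℕ) (iterLieDeriv X i G) Ω := by
  induction i with
  | zero => exact hG
  | succ i ih =>
    rw [iterLieDeriv_succ]
    refine contDiffOn_lieDeriv hΩ ?_ (hX.of_le (by norm_cast; omega))
    rw [show N - (i + 1) + 1 = N - i by omega]
    exact ih (by omega)

/-- The chain rule along an integral curve. It supplies high time derivatives up to the closed ends
of the interval without assuming more than `z' = X z`. -/
theorem isDerivChain_iterLieDeriv {Ω : Set V} (hΩ : IsOpen Ω) {X : V → V} {G : V → F} {N M : ℕ}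
    (hG : ContDiffOn ℝ N G Ω) (hX : ContDiffOn ℝ M X Ω) (hNM : N ≤ M + 1) {h : ℝ} {z : ℝ → V}
    (hz : ∀ t ∈ Icc 0 h, HasDerivWithinAt z (X (z t)) (Icc 0 h) t)
    (hzΩ : ∀ t ∈ Icc 0 h, z t ∈ Ω) :
    IsDerivChain N h (fun i t => iterLieDeriv X i G (z t)) := by
  refine ⟨fun i hi t ht => ?_, ?_⟩
  · have h1 := (contDiffOn_iterLieDeriv hΩ hG hX hNM hi.le).contDiffAt (hΩ.mem_nhds (hzΩ t ht))
    have h2 := (h1.differentiableAt (by norm_cast; omega)).hasFDerivAt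
    have h3 := h2.comp_hasDerivWithinAt t (hz t ht)
    simp only [iterLieDeriv_succ]
    exact h3
  · exact (contDiffOn_iterLieDeriv hΩ hG hX hNM le_rfl).continuousOn.comp
      (fun t ht => (hz t ht).continuousWithinAt) hzΩ

/-- The derivatives of `u` of order at most `k` vanish at `τ`. -/
def IsFlatAt (k : ℕ) (u : ℝ → F) (τ : ℝ) : Prop :=
  ∀ i ≤ k, iteratedDeriv i u τ = 0

theorem IsFlatAt.congr {k : ℕ} {u v : ℝ → F} {τ : ℝ} (hu : IsFlatAt k u τ) (h : u =ᶠ[𝓝 τ] v) :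
    IsFlatAt k v τ := fun i hi => by
  rw [← h.iteratedDeriv_eq i]
  exact hu i hi

/-- The derivative of `A u` is `A' u + A u'`, and both terms are flat to one order less. Used with
the fibre Hessian and with its inverse, this makes the two forms of the collocation conditions
equivalent. -/
theorem IsFlatAt.clm_apply {k : ℕ} {A : ℝ → F →L[ℝ] G} {u : ℝ → F} {τ : ℝ}
    (hu : IsFlatAt k u τ) (hA : ContDiffAt ℝ k A τ) (hu' : ContDiffAt ℝ k u τ) :
    IsFlatAt k (fun t => A t (u t)) τ := by
  induction k generalizing A u with
  | zero =>
    intro i hi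
    obtain rfl : i = 0 := by omega
    have := hu 0 le_rfl
    simp only [iteratedDeriv_zero] at this ⊢
    rw [this, map_zero]
  | succ k ih =>
    rintro (- | i) hi
    · have := hu 0 (Nat.zero_le _)
      simp only [iteratedDeriv_zero] at this ⊢
      rw [this, map_zero]
    · have hAk : ContDiffAt ℝ k A τ := hA.of_le (by norm_cast; omega)
      have huk : ContDiffAt ℝ k u τ := hu'.of_le (by norm_cast; omega)
      have hA1 : ContDiffAt ℝ k (deriv A) τ := hA.derivWithin (by norm_cast)
      have hu1 : ContDiffAt ℝ k (deriv u) τ := hu'.derivWithin (by norm_cast)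
      have hik : i ≤ k := by omega
      have hder : deriv (fun t => A t (u t)) =ᶠ[𝓝 τ]
          fun t => deriv A t (u t) + A t (deriv u t) := by
        filter_upwards [hA.eventually (by simp), hu'.eventually (by simp)] with t h1 h2
        exact ((h1.differentiableAt (by simp)).hasDerivAt.clm_apply
          (h2.differentiableAt (by simp)).hasDerivAt).deriv
      have hi' : ((i : ℕ) : WithTop ℕ∞) ≤ k := by exact_mod_cast hik
      rw [iteratedDeriv_succ', hder.iteratedDeriv_eq,
        iteratedDeriv_fun_add ((hA1.clm_apply huk).of_le hi') ((hAk.clm_apply hu1).of_le hi'),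
        ih (fun j hj => hu j (by omega)) hA1 huk i hik,
        ih (fun j hj => by rw [← iteratedDeriv_succ']; exact hu _ (by omega)) hAk hu1 i hik,
        add_zero]

/-- If a curve satisfies the equation `z' = X z` to order `k` at `τ`, its derivatives at `τ` agree
with those of an integral curve up to order `k + 1`. -/
theorem iteratedDeriv_comp_eq_iterLieDeriv {Ω : Set V} (hΩ : IsOpen Ω) {X : V → V} {G : V → F}
    {k : ℕ} (hG : ContDiffOn ℝ k G Ω) (hX : ContDiffOn ℝ (k - 1 : ℕ) X Ω) {z : ℝ → V} {τ : ℝ}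
    (hz : ContDiffAt ℝ k z τ) (hzΩ : z τ ∈ Ω)
    (hw : ∀ i < k, iteratedDeriv i (fun t => deriv z t - X (z t)) τ = 0) :
    iteratedDeriv k (fun t => G (z t)) τ = iterLieDeriv X k G (z τ) := by
  induction k generalizing G with
  | zero => simp [iterLieDeriv_zero]
  | succ k ih =>
    have hzk : ContDiffAt ℝ k z τ := hz.of_le (by norm_cast; omega)
    have hz1 : ContDiffAt ℝ k (deriv z) τ := hz.derivWithin (by norm_cast)
    have hX' : ContDiffOn ℝ k X Ω := hX
    have hΩτ := hΩ.mem_nhds hzΩ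
    have hlie := contDiffOn_lieDeriv hΩ hG hX'
    -- The derivative is the Lie derivative plus a linear operator applied to the defect `z' - X z`.
    -- The second term is flat and drops out; the induction hypothesis treats the first.
    have hder : deriv (fun t => G (z t)) =ᶠ[𝓝 τ] fun t => lieDeriv X G (z t) +
        fderiv ℝ G (z t) (deriv z t - X (z t)) := by
      filter_upwards [hz.eventually (by simp), hz.continuousAt.eventually (hΩ.eventually_mem hzΩ)]
        with t h1 h2
      have h3 := ((hG.contDiffAt (hΩ.mem_nhds h2)).differentiableAt (by simp)).hasFDerivAt
      have h4 : HasDerivAt (fun t => G (z t)) _ t :=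
        h3.comp_hasDerivAt t (h1.differentiableAt (by simp)).hasDerivAt
      rw [h4.deriv, lieDeriv, ← map_add, add_sub_cancel]
    have hA : ContDiffAt ℝ k (fun t => fderiv ℝ G (z t)) τ :=
      ((hG.fderiv_of_isOpen hΩ (m := k) (by norm_cast)).contDiffAt hΩτ).comp τ hzk
    have hw' : ContDiffAt ℝ k (fun t => deriv z t - X (z t)) τ :=
      hz1.sub ((hX'.contDiffAt hΩτ).comp τ hzk)
    have hflat : IsFlatAt k (fun t => deriv z t - X (z t)) τ := fun i hi => hw i (by omega)
    have hG' : ContDiffAt ℝ k (fun t => lieDeriv X G (z t)) τ :=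
      (hlie.contDiffAt hΩτ).comp τ hzk
    rw [iteratedDeriv_succ', hder.iteratedDeriv_eq,
      iteratedDeriv_fun_add hG' (hA.clm_apply hw'),
      hflat.clm_apply hA hw' k le_rfl, add_zero, iterLieDeriv_succ']
    exact ih hlie (hX'.of_le (by norm_cast; omega)) hzk fun i hi => hw i (by omega)

end LieDerivative

/-! ### The Euler-Lagrange equation as a smooth second-order equation -/

section EulerLagrangeField

open Filter Topology

variable {E : Type*} [NormedAddCommGroup E] [NormedSpace ℝ E]

/-- The fibre Hessian `∂²L/∂v²`. -/
noncomputable def fibreHessian (L : E × E → ℝ) (z : E × E) : E →L[ℝ] E →L[ℝ] ℝ :=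
  fderiv ℝ (fun w => partialV L (z.1, w)) z.2

/-- The acceleration `f(q, v)` for which the Euler-Lagrange equation reads `q'' = f(q, q')`. -/
noncomputable def accel (L : E × E → ℝ) (z : E × E) : E :=
  (fibreHessian L z).inverse (partialQ L z - fderiv ℝ (partialV L) z (z.2, 0))

/-- The Euler-Lagrange vector field on `TQ`. -/
noncomputable def elField (L : E × E → ℝ) (z : E × E) : E × E :=
  (z.2, accel L z)

variable {L : E × E → ℝ} {Ω : Set (E × E)} {N : ℕ}

theorem contDiffOn_partialQ (hΩ : IsOpen Ω) (hL : ContDiffOn ℝ (N + 1 : ℕ) L Ω) :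
    ContDiffOn ℝ N (partialQ L) Ω := by
  have h1 : ContDiffOn ℝ N (fun z => (fderiv ℝ L z) ∘L ContinuousLinearMap.inl ℝ E E) Ω :=
    (hL.fderiv_of_isOpen hΩ (m := N) (by norm_cast)).clm_comp contDiffOn_const
  refine h1.congr fun z hz => ?_
  have h2 := ((hL.contDiffAt (hΩ.mem_nhds hz)).differentiableAt (by simp)).hasFDerivAt
  exact (HasFDerivAt.comp z.1 (f := fun x => (x, z.2)) h2 (hasFDerivAt_prodMk_left z.1 z.2)).fderiv

theorem contDiffOn_partialV (hΩ : IsOpen Ω) (hL : ContDiffOn ℝ (N + 1 : ℕ) L Ω) :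
    ContDiffOn ℝ N (partialV L) Ω := by
  have h1 : ContDiffOn ℝ N (fun z => (fderiv ℝ L z) ∘L ContinuousLinearMap.inr ℝ E E) Ω :=
    (hL.fderiv_of_isOpen hΩ (m := N) (by norm_cast)).clm_comp contDiffOn_const
  refine h1.congr fun z hz => ?_
  have h2 := ((hL.contDiffAt (hΩ.mem_nhds hz)).differentiableAt (by simp)).hasFDerivAt
  exact (HasFDerivAt.comp z.2 (f := fun w => (z.1, w)) h2 (hasFDerivAt_prodMk_right z.1 z.2)).fderiv

theorem hasFDerivAt_partialV (hΩ : IsOpen Ω) (hL : ContDiffOn ℝ (N + 2 : ℕ) L Ω) {z : E × E}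
    (hz : z ∈ Ω) : HasFDerivAt (partialV L) (fderiv ℝ (partialV L) z) z :=
  (((contDiffOn_partialV (N := N + 1) hΩ hL).contDiffAt (hΩ.mem_nhds hz)).differentiableAt
    (by simp)).hasFDerivAt

theorem fibreHessian_eq (hΩ : IsOpen Ω) (hL : ContDiffOn ℝ (N + 2 : ℕ) L Ω) {z : E × E}
    (hz : z ∈ Ω) :
    fibreHessian L z = fderiv ℝ (partialV L) z ∘L ContinuousLinearMap.inr ℝ E E :=
  (HasFDerivAt.comp z.2 (f := fun w => (z.1, w)) (hasFDerivAt_partialV hΩ hL hz)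
    (hasFDerivAt_prodMk_right z.1 z.2)).fderiv

theorem contDiffOn_fibreHessian (hΩ : IsOpen Ω) (hL : ContDiffOn ℝ (N + 2 : ℕ) L Ω) :
    ContDiffOn ℝ N (fibreHessian L) Ω := by
  refine ContDiffOn.congr ?_ fun z hz => fibreHessian_eq hΩ hL hz
  exact ((contDiffOn_partialV (N := N + 1) hΩ hL).fderiv_of_isOpen hΩ (by norm_cast)).clm_comp
    contDiffOn_const

variable [FiniteDimensional ℝ E]

theorem isInvertible_of_bijective {F : Type*} [NormedAddCommGroup F] [NormedSpace ℝ F]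
    {A : E →L[ℝ] F} (hA : Function.Bijective A) : A.IsInvertible :=
  ⟨(LinearEquiv.ofBijective (A : E →ₗ[ℝ] F) hA).toContinuousLinearEquiv, by ext; rfl⟩

theorem contDiffOn_inverse_fibreHessian (hΩ : IsOpen Ω) (hL : ContDiffOn ℝ (N + 2 : ℕ) L Ω)
    (hreg : ∀ z ∈ Ω, Function.Bijective (fibreHessian L z)) :
    ContDiffOn ℝ N (fun z => (fibreHessian L z).inverse) Ω := by
  have := FiniteDimensional.complete ℝ E
  intro z hz
  exact ((isInvertible_of_bijective (hreg z hz)).contDiffAt_map_inverse).comp_contDiffWithinAt z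
    (contDiffOn_fibreHessian hΩ hL z hz)

theorem contDiffOn_accel (hΩ : IsOpen Ω) (hL : ContDiffOn ℝ (N + 2 : ℕ) L Ω)
    (hreg : ∀ z ∈ Ω, Function.Bijective (fibreHessian L z)) : ContDiffOn ℝ N (accel L) Ω := by
  refine (contDiffOn_inverse_fibreHessian hΩ hL hreg).clm_apply (ContDiffOn.sub ?_ ?_)
  · exact (contDiffOn_partialQ (N := N + 1) hΩ hL).of_le (by norm_cast; omega)
  · exact ((contDiffOn_partialV (N := N + 1) hΩ hL).fderiv_of_isOpen hΩ (by norm_cast)).clm_apply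
      (contDiff_snd.prodMk contDiff_const).contDiffOn

theorem contDiffOn_elField (hΩ : IsOpen Ω) (hL : ContDiffOn ℝ (N + 2 : ℕ) L Ω)
    (hreg : ∀ z ∈ Ω, Function.Bijective (fibreHessian L z)) : ContDiffOn ℝ N (elField L) Ω :=
  contDiff_snd.contDiffOn.prodMk (contDiffOn_accel hΩ hL hreg)

/-- The left side is affine in the acceleration `u`, with linear part minus the fibre Hessian, and
`accel L z` is its unique zero. -/
theorem partialQ_sub_fderiv_partialV (hΩ : IsOpen Ω) (hL : ContDiffOn ℝ (N + 2 : ℕ) L Ω)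
    (hreg : ∀ z ∈ Ω, Function.Bijective (fibreHessian L z)) {z : E × E} (hz : z ∈ Ω) (u : E) :
    partialQ L z - fderiv ℝ (partialV L) z (z.2, u) = fibreHessian L z (accel L z - u) := by
  rw [map_sub, accel, (isInvertible_of_bijective (hreg z hz)).self_apply_inverse,
    fibreHessian_eq hΩ hL hz]
  have : (z.2, u) = (z.2, 0) + ContinuousLinearMap.inr ℝ E E u := by simp
  rw [this, map_add, ContinuousLinearMap.comp_apply, sub_add_eq_sub_sub]

end EulerLagrangeField

/-! ### Degree and smoothness of curves in phase space -/

section PhaseCurves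

variable {E : Type*} [NormedAddCommGroup E] [NormedSpace ℝ E]

theorem polyCurve_of_deriv_deriv {K : ℕ} {p : ℝ → E} (hp : Differentiable ℝ p)
    (hp' : Differentiable ℝ (deriv p)) (h : deriv (deriv p) ∈ polyCurve E K) :
    p ∈ polyCurve E (K + 2) := by
  have step : ∀ {K : ℕ} {u : ℝ → E}, Differentiable ℝ u → deriv u ∈ polyCurve E K →
      u ∈ polyCurve E (K + 1) := by
    intro K u hu h
    obtain ⟨s, hs, hs'⟩ := exists_hasDerivAt_mem_polyCurve h
    have hc : ∀ t, u t - s t = u 0 - s 0 := fun t =>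
      is_const_of_deriv_eq_zero (f := fun t => u t - s t)
        (fun t => (hu t).sub (hs' t).differentiableAt)
        (fun t => by
          have := ((hu t).hasDerivAt.sub (hs' t)).deriv
          rw [sub_self] at this
          exact this) t 0
    have : u = s + fun t => (Polynomial.C 1 : Polynomial ℝ).eval t • (u 0 - s 0) := by
      ext t
      have := hc t
      simp [← this]
    rw [this]
    refine add_mem hs (eval_smul_mem_polyCurve ?_ _)
    exact Polynomial.degree_C_le.trans_lt (by exact_mod_cast Nat.succ_pos _)
  exact step hp (step hp' h)

theorem contDiffAt_comp_of_contDiffOn {V F : Type*} [NormedAddCommGroup V] [NormedSpace ℝ V]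
    [NormedAddCommGroup F] [NormedSpace ℝ F] {Ω : Set V} (hΩ : IsOpen Ω) {G : V → F} {m k : ℕ}
    (hG : ContDiffOn ℝ m G Ω) (hk : k ≤ m) {z : ℝ → V} {τ : ℝ} (hz : ContDiffAt ℝ k z τ)
    (hτ : z τ ∈ Ω) : ContDiffAt ℝ k (fun t => G (z t)) τ :=
  ((hG.contDiffAt (hΩ.mem_nhds hτ)).of_le (by exact_mod_cast hk)).comp τ hz

end PhaseCurves

/-! ### Collocation conditions as Hermite data for the second derivative -/

section Collocation

open Filter Topology

variable {E : Type*} [NormedAddCommGroup E] [NormedSpace ℝ E] [FiniteDimensional ℝ E]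
  {L : E × E → ℝ} {Q : Set E} {N : ℕ}

/-- A general `I` is kept so that the identity serves both solutions on `[0, h]`, with one-sided
derivatives, and polynomials on the whole line. -/
theorem eulerLagrange_eq (hQ : IsOpen Q) (hL : ContDiffOn ℝ (N + 2 : ℕ) L (Q ×ˢ univ))
    (hreg : IsRegularLagrangian Q L) {q : ℝ → E} {I : Set ℝ} {t : ℝ} (hI : UniqueDiffWithinAt ℝ I t)
    (hqt : q t ∈ Q) (hq : DifferentiableWithinAt ℝ q I t)
    (hq' : DifferentiableWithinAt ℝ (derivWithin q I) I t) :
    eulerLagrange L q I t = fibreHessian L (q t, derivWithin q I t)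
      (accel L (q t, derivWithin q I t) - derivWithin (derivWithin q I) I t) := by
  have hΩ : IsOpen (Q ×ˢ (univ : Set E)) := hQ.prod isOpen_univ
  have hz : (q t, derivWithin q I t) ∈ Q ×ˢ (univ : Set E) := ⟨hqt, mem_univ _⟩
  have h1 : HasDerivWithinAt (fun s => partialV L (q s, derivWithin q I s)) _ I t :=
    HasFDerivAt.comp_hasDerivWithinAt t (f := fun s => (q s, derivWithin q I s))
      (hasFDerivAt_partialV hΩ hL hz) (hq.hasDerivWithinAt.prodMk hq'.hasDerivWithinAt)
  rw [eulerLagrange, h1.derivWithin hI,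
    ← partialQ_sub_fderiv_partialV hΩ hL hreg hz]

/-- Injectivity of the fibre Hessian allows the Euler-Lagrange equation to be solved for the
acceleration. -/
theorem IsSolutionCurve.hasDerivWithinAt (hQ : IsOpen Q)
    (hL : ContDiffOn ℝ (N + 2 : ℕ) L (Q ×ˢ univ)) (hreg : IsRegularLagrangian Q L) {h : ℝ}
    (hh : 0 < h) {q : ℝ → E} (hq : IsSolutionCurve Q L h q) {t : ℝ} (ht : t ∈ Icc 0 h) :
    HasDerivWithinAt (fun s => (q s, derivWithin q (Icc 0 h) s))
      (elField L (q t, derivWithin q (Icc 0 h) t)) (Icc 0 h) t := by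
  have hI := uniqueDiffOn_Icc hh
  have h1 := hq.contDiffOn.differentiableOn (by norm_num) t ht
  have h2 := (hq.contDiffOn.derivWithin hI (m := 1) (by norm_num)).differentiableOn
    (by norm_num) t ht
  have h3 := hq.eulerLagrange_eq t ht
  rw [PCVariational.eulerLagrange_eq hQ hL hreg (hI t ht) (hq.mem t ht) h1 h2] at h3
  have h4 := (isInvertible_of_bijective (hreg _ ⟨hq.mem t ht, mem_univ _⟩)).injective
    (h3.trans (map_zero _).symm)
  have h5 := h1.hasDerivWithinAt.prodMk h2.hasDerivWithinAt
  rwa [← sub_eq_zero.1 h4] at h5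

variable {M : ℕ} {p : ℝ → E} {τ : ℝ}

/-- Along a polynomial curve the Euler-Lagrange expression vanishes to order `k` if and only if
the second order equation `p'' = f(p, p')` holds to order `k`. -/
theorem iteratedDeriv_eulerLagrange_eq_zero_iff (hQ : IsOpen Q)
    (hL : ContDiffOn ℝ (N + 2 : ℕ) L (Q ×ˢ univ)) (hreg : IsRegularLagrangian Q L)
    (hp : p ∈ polyCurve E (M + 2)) (hτ : p τ ∈ Q) {k : ℕ} (hk : k ≤ N) :
    (∀ i ≤ k, iteratedDeriv i (eulerLagrange L p univ) τ = 0) ↔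
      IsFlatAt k (fun t => accel L (p t, deriv p t) - deriv (deriv p) t) τ := by
  have hΩ : IsOpen (Q ×ˢ (univ : Set E)) := hQ.prod isOpen_univ
  have hp0 := contDiff_of_mem_polyCurve hp
  have hp1 := contDiff_of_mem_polyCurve (deriv_mem_polyCurve hp)
  have hp2 := contDiff_of_mem_polyCurve (deriv_mem_polyCurve (deriv_mem_polyCurve hp))
  have hz : ContDiffAt ℝ k (fun t => (p t, deriv p t)) τ :=
    ((hp0 k).prodMk (hp1 k)).contDiffAt
  have hev : ∀ᶠ t in 𝓝 τ, p t ∈ Q :=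
    (hp0 0).continuous.continuousAt.eventually (hQ.eventually_mem hτ)
  have hmem : (p τ, deriv p τ) ∈ Q ×ˢ (univ : Set E) := ⟨hτ, mem_univ _⟩
  have hacc : ContDiffAt ℝ k (fun t => accel L (p t, deriv p t)) τ :=
    contDiffAt_comp_of_contDiffOn (z := fun t => (p t, deriv p t)) hΩ
      (contDiffOn_accel hΩ hL hreg) hk hz hmem
  have hA : ContDiffAt ℝ k (fun t => fibreHessian L (p t, deriv p t)) τ :=
    contDiffAt_comp_of_contDiffOn (z := fun t => (p t, deriv p t)) hΩ
      (contDiffOn_fibreHessian hΩ hL) hk hz hmem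
  have hA' : ContDiffAt ℝ k (fun t => (fibreHessian L (p t, deriv p t)).inverse) τ :=
    contDiffAt_comp_of_contDiffOn (z := fun t => (p t, deriv p t)) hΩ
      (contDiffOn_inverse_fibreHessian hΩ hL hreg) hk hz hmem
  have hu : ContDiffAt ℝ k (fun t => accel L (p t, deriv p t) - deriv (deriv p) t) τ :=
    hacc.sub (hp2 k).contDiffAt
  have heq : eulerLagrange L p univ =ᶠ[𝓝 τ] fun t => fibreHessian L (p t, deriv p t)
      (accel L (p t, deriv p t) - deriv (deriv p) t) := by
    filter_upwards [hev] with t ht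
    have := eulerLagrange_eq (I := univ) (t := t) hQ hL hreg uniqueDiffWithinAt_univ ht
      ((hp0 1).differentiable one_ne_zero t).differentiableWithinAt
      (by rw [derivWithin_univ]
          exact ((hp1 1).differentiable one_ne_zero t).differentiableWithinAt)
    simpa only [derivWithin_univ] using this
  -- One direction multiplies the flat defect by the Hessian, the other multiplies the
  -- Euler-Lagrange expression by the inverse Hessian.
  refine ⟨fun h => ?_, fun h => (h.clm_apply hA hu).congr heq.symm⟩
  have h1 : IsFlatAt k (eulerLagrange L p univ) τ := h
  refine ((h1.congr heq).clm_apply hA' (hA.clm_apply hu)).congr ?_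
  filter_upwards [hev] with t ht
  exact (isInvertible_of_bijective (hreg (p t, deriv p t) ⟨ht, mem_univ _⟩)).inverse_apply_self _

/-- The position component of the defect vanishes identically, so only the acceleration defect
matters. -/
theorem iteratedDeriv_deriv_sub_elField_eq_zero (hQ : IsOpen Q)
    (hL : ContDiffOn ℝ (N + 2 : ℕ) L (Q ×ˢ univ)) (hreg : IsRegularLagrangian Q L)
    (hp : p ∈ polyCurve E (M + 2)) (hτ : p τ ∈ Q) {k : ℕ} (hk : k ≤ N)
    (hflat : IsFlatAt k (fun t => accel L (p t, deriv p t) - deriv (deriv p) t) τ) :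
    ∀ i ≤ k, iteratedDeriv i (fun t => deriv (fun t => (p t, deriv p t)) t -
      elField L (p t, deriv p t)) τ = 0 := by
  have hΩ : IsOpen (Q ×ˢ (univ : Set E)) := hQ.prod isOpen_univ
  have hp0 := contDiff_of_mem_polyCurve hp
  have hp1 := contDiff_of_mem_polyCurve (deriv_mem_polyCurve hp)
  have hp2 := contDiff_of_mem_polyCurve (deriv_mem_polyCurve (deriv_mem_polyCurve hp))
  have hz : ContDiffAt ℝ k (fun t => (p t, deriv p t)) τ :=
    ((hp0 k).prodMk (hp1 k)).contDiffAt
  have hmem : (p τ, deriv p τ) ∈ Q ×ˢ (univ : Set E) := ⟨hτ, mem_univ _⟩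
  have hacc : ContDiffAt ℝ k (fun t => accel L (p t, deriv p t)) τ :=
    contDiffAt_comp_of_contDiffOn (z := fun t => (p t, deriv p t)) hΩ
      (contDiffOn_accel hΩ hL hreg) hk hz hmem
  have h1 := hflat.clm_apply (A := fun _ => -ContinuousLinearMap.inr ℝ E E) contDiffAt_const
    (hacc.sub (hp2 k).contDiffAt)
  have e : (fun t => deriv (fun t => (p t, deriv p t)) t - elField L (p t, deriv p t)) =
      fun t => (-ContinuousLinearMap.inr ℝ E E) (accel L (p t, deriv p t) - deriv (deriv p) t) := by
    ext1 t
    have := (((hp0 1).differentiable one_ne_zero t).hasDerivAt.prodMk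
      ((hp1 1).differentiable one_ne_zero t).hasDerivAt).deriv
    rw [this]
    simp [elField]
  rw [e]
  exact h1

/-- Derivatives at a collocation point of a function of the phase point. -/
theorem iteratedDeriv_comp_eq_of_isFlatAt (hQ : IsOpen Q)
    (hL : ContDiffOn ℝ (N + 2 : ℕ) L (Q ×ˢ univ)) (hreg : IsRegularLagrangian Q L)
    (hp : p ∈ polyCurve E (M + 2)) (hτ : p τ ∈ Q) {k : ℕ} (hk : k ≤ N)
    (hflat : IsFlatAt k (fun t => accel L (p t, deriv p t) - deriv (deriv p) t) τ)
    {F : Type*} [NormedAddCommGroup F] [NormedSpace ℝ F] {G : E × E → F} {i : ℕ}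
    (hG : ContDiffOn ℝ i G (Q ×ˢ univ)) (hi : i ≤ k + 1) :
    iteratedDeriv i (fun t => G (p t, deriv p t)) τ =
      iterLieDeriv (elField L) i G (p τ, deriv p τ) := by
  have hΩ : IsOpen (Q ×ˢ (univ : Set E)) := hQ.prod isOpen_univ
  have hp0 := contDiff_of_mem_polyCurve hp
  have hp1 := contDiff_of_mem_polyCurve (deriv_mem_polyCurve hp)
  exact iteratedDeriv_comp_eq_iterLieDeriv (z := fun t => (p t, deriv p t)) hΩ hG
    ((contDiffOn_elField hΩ hL hreg).of_le (by norm_cast; omega))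
    ((hp0 i).prodMk (hp1 i)).contDiffAt ⟨hτ, mem_univ _⟩ fun j hj =>
      iteratedDeriv_deriv_sub_elField_eq_zero hQ hL hreg hp hτ hk hflat j (by omega)

/-- The second order equation holds to order `k` if and only if the derivatives of `p''` up to
order `k` have the values prescribed by the position and the velocity. -/
theorem isFlatAt_iff_iteratedDeriv_eq (hQ : IsOpen Q)
    (hL : ContDiffOn ℝ (N + 2 : ℕ) L (Q ×ˢ univ)) (hreg : IsRegularLagrangian Q L)
    (hp : p ∈ polyCurve E (M + 2)) (hτ : p τ ∈ Q) {k : ℕ} (hk : k ≤ N) :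
    IsFlatAt k (fun t => accel L (p t, deriv p t) - deriv (deriv p) t) τ ↔
      ∀ i ≤ k, iteratedDeriv i (deriv (deriv p)) τ =
        iterLieDeriv (elField L) i (accel L) (p τ, deriv p τ) := by
  have hΩ : IsOpen (Q ×ˢ (univ : Set E)) := hQ.prod isOpen_univ
  have hp0 := contDiff_of_mem_polyCurve hp
  have hp1 := contDiff_of_mem_polyCurve (deriv_mem_polyCurve hp)
  have hp2 := contDiff_of_mem_polyCurve (deriv_mem_polyCurve (deriv_mem_polyCurve hp))
  have hmem : (p τ, deriv p τ) ∈ Q ×ˢ (univ : Set E) := ⟨hτ, mem_univ _⟩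
  have hacc : ContDiffOn ℝ k (accel L) (Q ×ˢ (univ : Set E)) :=
    (contDiffOn_accel hΩ hL hreg).of_le (by exact_mod_cast hk)
  have hsub : ∀ i ≤ k, iteratedDeriv i
      (fun t => accel L (p t, deriv p t) - deriv (deriv p) t) τ =
      iteratedDeriv i (fun t => accel L (p t, deriv p t)) τ -
        iteratedDeriv i (deriv (deriv p)) τ := by
    intro i hi
    have hacc' : ContDiffAt ℝ i (fun t => accel L (p t, deriv p t)) τ :=
      contDiffAt_comp_of_contDiffOn (z := fun t => (p t, deriv p t)) hΩ hacc hi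
        ((hp0 i).prodMk (hp1 i)).contDiffAt hmem
    exact iteratedDeriv_sub hacc' (hp2 i).contDiffAt
  constructor
  · intro h i hi
    have h1 := h i hi
    rw [hsub i hi, iteratedDeriv_comp_eq_of_isFlatAt hQ hL hreg hp hτ hk h
      (hacc.of_le (by exact_mod_cast hi)) (by omega)] at h1
    exact (sub_eq_zero.1 h1).symm
  · intro h i
    -- Flatness up to order `i` already fixes the derivative of order `i + 1` of `f(p, p')`, which
    -- is then compared with the prescribed one of `p''`.
    induction i using Nat.strong_induction_on with
    | _ i ih =>
      intro hi
      rw [hsub i hi, h i hi, sub_eq_zero]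
      rcases i with - | i
      · simp [iterLieDeriv_zero]
      · exact iteratedDeriv_comp_eq_of_isFlatAt hQ hL hreg hp hτ (k := i) (by omega)
          (fun j hj => ih j (by omega) (by omega))
          (hacc.of_le (by exact_mod_cast hi)) le_rfl

/-- The derivatives of the acceleration at `(x, v)` prescribed by the Euler-Lagrange equation. -/
noncomputable def accelJet (L : E × E → ℝ) (n : ℕ) (z : E × E) (i : Fin n) : E :=
  iterLieDeriv (elField L) i (accel L) z

/-- The prescribed values depend on `p` only through its endpoint velocities, so the collocation
problem becomes a fixed point problem in `E × E`. -/
theorem isCollocationCurve_iff (hQ : IsOpen Q) {n : ℕ}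
    (hL : ContDiffOn ℝ ((2 * (n + 2) : ℕ) : WithTop ℕ∞) L (Q ×ˢ univ))
    (hreg : IsRegularLagrangian Q L) {h : ℝ} (hh : h ≠ 0) {x₀ x₁ : E} (hx₀ : x₀ ∈ Q) (hx₁ : x₁ ∈ Q)
    {p : ℝ → E} :
    IsCollocationCurve L (n + 2) h x₀ x₁ p ↔
      p 0 = x₀ ∧ p h = x₁ ∧ Differentiable ℝ p ∧ Differentiable ℝ (deriv p) ∧
        deriv (deriv p) = hermiteInterpolant (n + 1) h
          (accelJet L (n + 1) (x₀, deriv p 0)) (accelJet L (n + 1) (x₁, deriv p h)) := by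
  have hL' : ContDiffOn ℝ ((2 * n + 2) + 2 : ℕ) L (Q ×ˢ univ) := hL
  constructor
  · rintro ⟨⟨a, b, hab⟩, h0, h1, c0, c1⟩
    have hp : p ∈ polyCurve E (2 * (n + 1) + 2) := by
      rw [hab]; exact hermiteInterpolant_mem_polyCurve (n + 2) h a b
    have hp0 : p 0 ∈ Q := by rwa [h0]
    have hp1 : p h ∈ Q := by rwa [h1]
    refine ⟨h0, h1, (contDiff_of_mem_polyCurve hp 1).differentiable one_ne_zero,
      (contDiff_of_mem_polyCurve (deriv_mem_polyCurve hp) 1).differentiable one_ne_zero, ?_⟩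
    rw [iteratedDeriv_eulerLagrange_eq_zero_iff hQ hL' hreg hp hp0 (by omega),
      isFlatAt_iff_iteratedDeriv_eq hQ hL' hreg hp hp0 (by omega)] at c0
    rw [iteratedDeriv_eulerLagrange_eq_zero_iff hQ hL' hreg hp hp1 (by omega),
      isFlatAt_iff_iteratedDeriv_eq hQ hL' hreg hp hp1 (by omega)] at c1
    rw [eq_hermiteInterpolant_of_mem_polyCurve hh
      (deriv_mem_polyCurve (deriv_mem_polyCurve hp))]
    congr 1
    · ext i
      rw [c0 i (by omega), h0, accelJet]
    · ext i
      rw [c1 i (by omega), h1, accelJet]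
  · rintro ⟨h0, h1, hd, hd', h2⟩
    have hp : p ∈ polyCurve E (2 * (n + 1) + 2) := polyCurve_of_deriv_deriv hd hd'
      (by rw [h2]; exact hermiteInterpolant_mem_polyCurve _ _ _ _)
    have hp0 : p 0 ∈ Q := by rwa [h0]
    have hp1 : p h ∈ Q := by rwa [h1]
    refine ⟨⟨_, _, eq_hermiteInterpolant_of_mem_polyCurve (n := n + 2) hh hp⟩, h0, h1, ?_, ?_⟩
    · rw [iteratedDeriv_eulerLagrange_eq_zero_iff hQ hL' hreg hp hp0 (by omega),
        isFlatAt_iff_iteratedDeriv_eq hQ hL' hreg hp hp0 (by omega)]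
      intro i hi
      rw [h2]
      exact (iteratedDeriv_hermiteInterpolant_zero hh _ _ ⟨i, by omega⟩).trans (by rw [h0, accelJet])
    · rw [iteratedDeriv_eulerLagrange_eq_zero_iff hQ hL' hreg hp hp1 (by omega),
        isFlatAt_iff_iteratedDeriv_eq hQ hL' hreg hp hp1 (by omega)]
      intro i hi
      rw [h2]
      exact (iteratedDeriv_hermiteInterpolant_right hh _ _ ⟨i, by omega⟩).trans
        (by rw [h1, accelJet])

/-- The discrete Lagrangian of a collocation curve depends only on its endpoint phase points. -/
theorem IsCollocationCurve.iteratedDeriv_lagrangian (hQ : IsOpen Q) {n : ℕ}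
    (hL : ContDiffOn ℝ ((2 * (n + 2) : ℕ) : WithTop ℕ∞) L (Q ×ˢ univ))
    (hreg : IsRegularLagrangian Q L) {h : ℝ} {x₀ x₁ : E} (hx₀ : x₀ ∈ Q) (hx₁ : x₁ ∈ Q)
    {p : ℝ → E} (hpc : IsCollocationCurve L (n + 2) h x₀ x₁ p) {i : ℕ} (hi : i ≤ n + 1) :
    iteratedDeriv i (fun t => L (p t, deriv p t)) 0 =
        iterLieDeriv (elField L) i L (x₀, deriv p 0) ∧
      iteratedDeriv i (fun t => L (p t, deriv p t)) h =
        iterLieDeriv (elField L) i L (x₁, deriv p h) := by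
  have hL' : ContDiffOn ℝ ((2 * n + 2) + 2 : ℕ) L (Q ×ˢ univ) := hL
  obtain ⟨⟨a, b, hab⟩, h0, h1, c0, c1⟩ := hpc
  have hp : p ∈ polyCurve E (2 * (n + 1) + 2) := by
    rw [hab]; exact hermiteInterpolant_mem_polyCurve (n + 2) h a b
  have hp0 : p 0 ∈ Q := by rwa [h0]
  have hp1 : p h ∈ Q := by rwa [h1]
  rw [iteratedDeriv_eulerLagrange_eq_zero_iff hQ hL' hreg hp hp0 (by omega)] at c0
  rw [iteratedDeriv_eulerLagrange_eq_zero_iff hQ hL' hreg hp hp1 (by omega)] at c1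
  have hLi : ContDiffOn ℝ i L (Q ×ˢ univ) := hL'.of_le (by norm_cast; omega)
  exact ⟨by rw [iteratedDeriv_comp_eq_of_isFlatAt hQ hL' hreg hp hp0 (by omega) c0 hLi (by omega),
      h0],
    by rw [iteratedDeriv_comp_eq_of_isFlatAt hQ hL' hreg hp hp1 (by omega) c1 hLi (by omega), h1]⟩

end Collocation

/-! ### Taylor polynomials and the linear boundary value problem -/

section Interpolation

variable {E : Type*} [NormedAddCommGroup E] [NormedSpace ℝ E]

theorem const_mem_polyCurve (N : ℕ) (x : E) : (fun _ => x) ∈ polyCurve E (N + 1) := by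
  have := eval_smul_mem_polyCurve (N := N + 1) (P := Polynomial.C 1)
    (Polynomial.degree_C_le.trans_lt (by exact_mod_cast Nat.succ_pos _)) x
  simpa using this

theorem iteratedDeriv_eq_zero_of_mem_polyCurve {N : ℕ} {r : ℝ → E} (hr : r ∈ polyCurve E N) :
    iteratedDeriv N r = 0 := by
  induction N generalizing r with
  | zero =>
    rw [iteratedDeriv_zero]
    exact eq_zero_of_mem_polyCurve (k := 0) hr one_ne_zero (by simp) (by simp)
  | succ N ih =>
    rw [iteratedDeriv_succ']
    exact ih (deriv_mem_polyCurve hr)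

theorem exists_mem_polyCurve_iteratedDeriv_eq (N : ℕ) (c : ℕ → E) :
    ∃ T ∈ polyCurve E N, ∀ i < N, iteratedDeriv i T 0 = c i := by
  induction N generalizing c with
  | zero => exact ⟨0, zero_mem _, by simp⟩
  | succ N ih =>
    obtain ⟨T, hT, hTi⟩ := ih fun i => c (i + 1)
    obtain ⟨s, hs, hs'⟩ := exists_hasDerivAt_mem_polyCurve hT
    refine ⟨s + fun _ => c 0 - s 0, add_mem hs (const_mem_polyCurve N _), ?_⟩
    have hd : deriv (s + fun _ => c 0 - s 0) = T := by
      ext t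
      have := ((hs' t).add (hasDerivAt_const t (c 0 - s 0))).deriv
      rwa [add_zero] at this
    rintro (- | i) hi
    · simp
    · rw [iteratedDeriv_succ', hd]
      exact hTi i (by omega)

/-- The two-point boundary value problem `p'' = g`, `p 0 = x₀`, `p h = x₁`. -/
theorem exists_deriv_deriv_eq {K : ℕ} {g : ℝ → E} (hg : g ∈ polyCurve E K) {h : ℝ} (hh : h ≠ 0)
    (x₀ x₁ : E) : ∃ p : ℝ → E, Differentiable ℝ p ∧ Differentiable ℝ (deriv p) ∧
      deriv (deriv p) = g ∧ p 0 = x₀ ∧ p h = x₁ := by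
  obtain ⟨s, hs, hs'⟩ := exists_hasDerivAt_mem_polyCurve hg
  obtain ⟨r, hr, hr'⟩ := exists_hasDerivAt_mem_polyCurve hs
  set c : E := h⁻¹ • ((x₁ - r h) - (x₀ - r 0)) with hc
  have hp : ∀ t, HasDerivAt (fun t => r t + (t • c + (x₀ - r 0))) (s t + c) t := fun t => by
    have := (hr' t).add (((hasDerivAt_id t).smul_const c).add_const (x₀ - r 0))
    rwa [one_smul] at this
  have hp1 : deriv (fun t => r t + (t • c + (x₀ - r 0))) = fun t => s t + c :=
    funext fun t => (hp t).deriv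
  have hp2 : ∀ t, HasDerivAt (fun t => s t + c) (g t) t := fun t => (hs' t).add_const c
  refine ⟨fun t => r t + (t • c + (x₀ - r 0)), fun t => (hp t).differentiableAt, ?_, ?_, ?_, ?_⟩
  · rw [hp1]; exact fun t => (hp2 t).differentiableAt
  · rw [hp1]; exact funext fun t => (hp2 t).deriv
  · simp
  · simp only [hc, smul_inv_smul₀ hh]
    abel

/-- The difference is affine and vanishes at both ends: unisolvence with `k = 1`. -/
theorem eq_of_deriv_deriv_eq {p q : ℝ → E} (hp : Differentiable ℝ p)
    (hp' : Differentiable ℝ (deriv p)) (hq : Differentiable ℝ q) (hq' : Differentiable ℝ (deriv q))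
    (hpq : deriv (deriv p) = deriv (deriv q)) {h : ℝ} (hh : h ≠ 0) (h0 : p 0 = q 0)
    (h1 : p h = q h) : p = q := by
  have hd : deriv (p - q) = deriv p - deriv q := funext fun t => deriv_sub (hp t) (hq t)
  have hd' : deriv (deriv (p - q)) = 0 := by
    rw [hd]
    ext t
    rw [deriv_sub (hp' t) (hq' t), hpq, sub_self, Pi.zero_apply]
  have hmem : p - q ∈ polyCurve E (0 + 2) := polyCurve_of_deriv_deriv (hp.sub hq)
    (by rw [hd]; exact hp'.sub hq') (by rw [hd']; exact zero_mem _)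
  refine sub_eq_zero.1 (eq_zero_of_mem_polyCurve (k := 1) hmem hh ?_ ?_)
  · intro i hi
    obtain rfl : i = 0 := by omega
    simp [h0]
  · intro i hi
    obtain rfl : i = 0 := by omega
    simp [h1]

end Interpolation

/-! ### Uniform bounds on compact sets of phase points -/

section Bounds

variable {E F : Type*} [NormedAddCommGroup E] [NormedSpace ℝ E] [NormedAddCommGroup F]
  [NormedSpace ℝ F]

theorem exists_forall_le_of_mono {P : ℕ → ℝ → Prop} (hP : ∀ i a b, a ≤ b → P i a → P i b) (n : ℕ)
    (h : ∀ i ≤ n, ∃ C, P i C) : ∃ C, 0 ≤ C ∧ ∀ i ≤ n, P i C := by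
  induction n with
  | zero =>
    obtain ⟨C, hC⟩ := h 0 le_rfl
    refine ⟨max C 0, le_max_right _ _, fun i hi => ?_⟩
    obtain rfl : i = 0 := by omega
    exact hP _ _ _ (le_max_left _ _) hC
  | succ n ih =>
    obtain ⟨C, hC0, hC⟩ := ih fun i hi => h i (by omega)
    obtain ⟨C', hC'⟩ := h (n + 1) le_rfl
    refine ⟨max C C', hC0.trans (le_max_left _ _), fun i hi => ?_⟩
    rcases hi.lt_or_eq with hi | rfl
    · exact hP _ _ _ (le_max_left _ _) (hC i (by omega))
    · exact hP _ _ _ (le_max_right _ _) hC'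

variable [FiniteDimensional ℝ E]

theorem exists_norm_le_on_phase {F : Type*} [NormedAddCommGroup F] {Q K : Set E}
    (hK : IsCompact K) (hKQ : K ⊆ Q) (R : ℝ) {G : E × E → F} (hG : ContinuousOn G (Q ×ˢ univ)) :
    ∃ C, ∀ x ∈ K, ∀ v, ‖v‖ ≤ R → ‖G (x, v)‖ ≤ C := by
  have := FiniteDimensional.proper ℝ E
  obtain ⟨C, hC⟩ := (hK.prod (isCompact_closedBall (0 : E) R)).exists_bound_of_continuousOn
    (hG.mono (prod_mono hKQ (subset_univ _)))
  exact ⟨C, fun x hx v hv => hC (x, v) ⟨hx, by simpa using hv⟩⟩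

/-- Only the velocity varies, because the curves being compared share their endpoint positions. The
mean value inequality therefore runs inside a ball of velocities, and no convexity of `K` is
required. -/
theorem exists_lipschitz_on_phase {Q K : Set E} (hQ : IsOpen Q) (hK : IsCompact K) (hKQ : K ⊆ Q)
    (R : ℝ) {G : E × E → F} {m : ℕ} (hm : 1 ≤ m) (hG : ContDiffOn ℝ m G (Q ×ˢ univ)) :
    ∃ C, ∀ x ∈ K, ∀ v w, ‖v‖ ≤ R → ‖w‖ ≤ R → ‖G (x, v) - G (x, w)‖ ≤ C * ‖v - w‖ := by
  have hΩ : IsOpen (Q ×ˢ (univ : Set E)) := hQ.prod isOpen_univ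
  have hG1 : ContDiffOn ℝ 1 G (Q ×ˢ univ) := hG.of_le (by exact_mod_cast hm)
  have hc : ContDiffOn ℝ 0 (fun z => fderiv ℝ G z ∘L ContinuousLinearMap.inr ℝ E E)
      (Q ×ˢ univ) :=
    (hG1.fderiv_of_isOpen hΩ (m := 0) (by norm_num)).clm_comp contDiffOn_const
  obtain ⟨C, hC⟩ := exists_norm_le_on_phase hK hKQ R hc.continuousOn
  refine ⟨C, fun x hx v w hv hw => ?_⟩
  refine (convex_closedBall (0 : E) R).norm_image_sub_le_of_norm_hasFDerivWithin_le (𝕜 := ℝ)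
    (f := fun u => G (x, u)) (f' := fun u => fderiv ℝ G (x, u) ∘L ContinuousLinearMap.inr ℝ E E)
    (fun u _ => ?_) (fun u hu => hC x hx u (by simpa using hu)) (by simpa using hw)
    (by simpa using hv)
  have h1 := ((hG1.contDiffAt (hΩ.mem_nhds (x := (x, u)) ⟨hKQ hx, mem_univ _⟩)).differentiableAt
    (by simp)).hasFDerivAt
  exact (HasFDerivAt.comp u (f := fun w => (x, w)) h1 (hasFDerivAt_prodMk_right x u)).hasFDerivWithinAt

/-- Uniform bounds, over positions in `K` and velocities of norm at most `R`, on the derivatives of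
the acceleration and of the Lagrangian along the Euler-Lagrange flow. -/
structure PhaseBounds (L : E × E → ℝ) (n : ℕ) (K : Set E) (R M : ℝ) : Prop where
  nonneg : 0 ≤ M
  accel_lipschitz : ∀ i ≤ n, ∀ x ∈ K, ∀ v w, ‖v‖ ≤ R → ‖w‖ ≤ R →
    ‖iterLieDeriv (elField L) i (accel L) (x, v) - iterLieDeriv (elField L) i (accel L) (x, w)‖ ≤
      M * ‖v - w‖
  accel_bound : ∀ i ≤ 2 * n + 2, ∀ x ∈ K, ∀ v, ‖v‖ ≤ R →
    ‖iterLieDeriv (elField L) i (accel L) (x, v)‖ ≤ M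
  lagrangian_lipschitz : ∀ i ≤ n + 1, ∀ x ∈ K, ∀ v w, ‖v‖ ≤ R → ‖w‖ ≤ R →
    ‖iterLieDeriv (elField L) i L (x, v) - iterLieDeriv (elField L) i L (x, w)‖ ≤ M * ‖v - w‖
  lagrangian_bound : ∀ i ≤ 2 * n + 3, ∀ x ∈ K, ∀ v, ‖v‖ ≤ R →
    ‖iterLieDeriv (elField L) i L (x, v)‖ ≤ M

theorem exists_phaseBounds {Q : Set E} (hQ : IsOpen Q) {n : ℕ} {L : E × E → ℝ}
    (hL : ContDiffOn ℝ ((2 * (n + 2) : ℕ) : WithTop ℕ∞) L (Q ×ˢ univ))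
    (hreg : IsRegularLagrangian Q L) {K : Set E} (hK : IsCompact K) (hKQ : K ⊆ Q) (R : ℝ) :
    ∃ M, PhaseBounds L n K R M := by
  have hΩ : IsOpen (Q ×ˢ (univ : Set E)) := hQ.prod isOpen_univ
  have hL' : ContDiffOn ℝ ((2 * n + 2) + 2 : ℕ) L (Q ×ˢ univ) := hL
  have hX := contDiffOn_elField hΩ hL' hreg
  have hacc := fun (i : ℕ) (hi : i ≤ 2 * n + 2) =>
    contDiffOn_iterLieDeriv hΩ (contDiffOn_accel hΩ hL' hreg) hX (by omega) hi
  -- The field is only of class `2 * n + 2`, which limits the Lagrangian to `2 * n + 3` derivatives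
  -- along the flow.
  have hLag := fun (i : ℕ) (hi : i ≤ 2 * n + 3) =>
    contDiffOn_iterLieDeriv hΩ (N := 2 * n + 3) (hL'.of_le (by norm_cast; omega)) hX (by omega) hi
  obtain ⟨C₁, h₁, H₁⟩ := exists_forall_le_of_mono (P := fun i C => ∀ x ∈ K, ∀ v w, ‖v‖ ≤ R →
    ‖w‖ ≤ R → ‖iterLieDeriv (elField L) i (accel L) (x, v) -
      iterLieDeriv (elField L) i (accel L) (x, w)‖ ≤ C * ‖v - w‖)
    (fun i a b hab h x hx v w hv hw => (h x hx v w hv hw).trans (by gcongr)) n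
    (fun i hi => exists_lipschitz_on_phase hQ hK hKQ R (by omega) (hacc i (by omega)))
  obtain ⟨C₂, h₂, H₂⟩ := exists_forall_le_of_mono (P := fun i C => ∀ x ∈ K, ∀ v, ‖v‖ ≤ R →
    ‖iterLieDeriv (elField L) i (accel L) (x, v)‖ ≤ C)
    (fun i a b hab h x hx v hv => (h x hx v hv).trans hab) (2 * n + 2)
    (fun i hi => exists_norm_le_on_phase hK hKQ R (hacc i hi).continuousOn)
  obtain ⟨C₃, h₃, H₃⟩ := exists_forall_le_of_mono (P := fun i C => ∀ x ∈ K, ∀ v w, ‖v‖ ≤ R →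
    ‖w‖ ≤ R → ‖iterLieDeriv (elField L) i L (x, v) -
      iterLieDeriv (elField L) i L (x, w)‖ ≤ C * ‖v - w‖)
    (fun i a b hab h x hx v w hv hw => (h x hx v w hv hw).trans (by gcongr)) (n + 1)
    (fun i hi => exists_lipschitz_on_phase hQ hK hKQ R (by omega) (hLag i (by omega)))
  obtain ⟨C₄, h₄, H₄⟩ := exists_forall_le_of_mono (P := fun i C => ∀ x ∈ K, ∀ v, ‖v‖ ≤ R →
    ‖iterLieDeriv (elField L) i L (x, v)‖ ≤ C)
    (fun i a b hab h x hx v hv => (h x hx v hv).trans hab) (2 * n + 3)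
    (fun i hi => exists_norm_le_on_phase hK hKQ R (hLag i hi).continuousOn)
  refine ⟨C₁ + C₂ + C₃ + C₄, by positivity, ?_, ?_, ?_, ?_⟩
  · exact fun i hi x hx v w hv hw => (H₁ i hi x hx v w hv hw).trans (by gcongr; linarith)
  · exact fun i hi x hx v hv => (H₂ i hi x hx v hv).trans (by linarith)
  · exact fun i hi x hx v w hv hw => (H₃ i hi x hx v w hv hw).trans (by gcongr; linarith)
  · exact fun i hi x hx v hv => (H₄ i hi x hx v hv).trans (by linarith)

end Bounds

/-! ### Short-time confinement of solutions -/

section Flow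

/-- A trajectory whose speed is at most `B` while in the thickening cannot leave it before time `ε /
(B + 1)`. -/
theorem mem_cthickening_of_hasDerivWithinAt {V : Type*} [NormedAddCommGroup V] [NormedSpace ℝ V]
    {X : V → V} {S : Set V} {ε B h : ℝ} {z : ℝ → V}
    (hz : ∀ t ∈ Icc 0 h, HasDerivWithinAt z (X (z t)) (Icc 0 h) t) (h0 : z 0 ∈ S)
    (hB : ∀ y ∈ Metric.cthickening ε S, ‖X y‖ ≤ B) (hB0 : 0 ≤ B) (hBh : (B + 1) * h ≤ ε) :
    ∀ t ∈ Icc 0 h, z t ∈ Metric.cthickening ε S := by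
  have hle : ∀ t ≤ h, (B + 1) * t ≤ ε := fun t ht =>
    (mul_le_mul_of_nonneg_left ht (by positivity)).trans hBh
  -- The barrier has slope `B + 1` rather than `B` because the comparison needs a strict inequality
  -- at a point of contact.
  have key := image_norm_le_of_norm_deriv_right_lt_deriv_boundary' (f := fun t => z t - z 0)
    (a := 0) (b := h) (f' := fun t => X (z t)) (B := fun t => (B + 1) * t) (B' := fun _ => B + 1)
    (fun t ht => ((hz t ht).continuousWithinAt.sub continuousWithinAt_const))
    (fun t ht => ((hz t (Ico_subset_Icc_self ht)).mono_of_mem_nhdsWithin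
      (Icc_mem_nhdsGE_of_mem ht)).sub_const (z 0))
    (by simp) (by fun_prop)
    (fun t _ => by simpa using ((hasDerivWithinAt_id t (Ici t)).const_mul (B + 1)))
    (fun t ht hzt => by
      refine (hB _ (Metric.mem_cthickening_of_dist_le _ _ _ _ h0 ?_)).trans_lt (lt_add_one B)
      rw [dist_eq_norm, hzt]
      exact hle t ht.2.le)
  intro t ht
  refine Metric.mem_cthickening_of_dist_le _ _ _ _ h0 ?_
  rw [dist_eq_norm]
  exact (key ht).trans (hle t ht.2)

theorem exists_pos_forall_mul_le (c : ℝ) {d : ℝ} (hd : 0 < d) :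
    ∃ h₀, 0 < h₀ ∧ ∀ h, 0 < h → h ≤ h₀ → c * h ≤ d := by
  refine ⟨d / (|c| + 1), by positivity, fun h hh hle => ?_⟩
  rw [le_div_iff₀ (by positivity)] at hle
  nlinarith [le_abs_self c]

variable {E : Type*} [NormedAddCommGroup E] [NormedSpace ℝ E] [FiniteDimensional ℝ E]

/-- Solutions starting in a relatively compact set of phase points stay, for a short time, over
a fixed compact set of positions with a fixed bound on the velocities. -/
theorem exists_compact_of_isSolutionCurve {Q : Set E} (hQ : IsOpen Q) {N : ℕ} {L : E × E → ℝ}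
    (hL : ContDiffOn ℝ (N + 2 : ℕ) L (Q ×ˢ univ)) (hreg : IsRegularLagrangian Q L)
    {U : Set (E × E)} (hUne : U.Nonempty) (hUc : IsCompact (closure U))
    (hUQ : closure U ⊆ Q ×ˢ univ) {R : ℝ} (hR : ∀ z ∈ closure U, ‖z.2‖ < R) :
    ∃ K : Set E, IsCompact K ∧ K ⊆ Q ∧ ∃ R' < R, ∃ h₀, 0 < h₀ ∧ ∀ h, 0 < h → h ≤ h₀ →
      ∀ q, IsSolutionCurve Q L h q → (q 0, derivWithin q (Icc 0 h) 0) ∈ U →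
        ∀ t ∈ Icc 0 h, q t ∈ K ∧ ‖derivWithin q (Icc 0 h) t‖ ≤ R' := by
  have := FiniteDimensional.proper ℝ (E × E)
  have hΩ : IsOpen (Q ×ˢ (univ : Set E)) := hQ.prod isOpen_univ
  -- Including the bound on the velocity in the open set makes the compact thickening respect it
  -- too; the maximal speed there is the required `R' < R`.
  have hO : IsOpen ((Q ×ˢ (univ : Set E)) ∩ {z : E × E | ‖z.2‖ < R}) :=
    hΩ.inter (isOpen_lt (by fun_prop) continuous_const)
  obtain ⟨ε, hε, hsub⟩ := hUc.exists_cthickening_subset_open hO fun z hz => ⟨hUQ hz, hR z hz⟩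
  have hC : IsCompact (Metric.cthickening ε (closure U)) := hUc.cthickening
  have hCne : (Metric.cthickening ε (closure U)).Nonempty :=
    hUne.mono (subset_closure.trans (Metric.self_subset_cthickening _))
  obtain ⟨y, hy, hymax⟩ := hC.exists_isMaxOn hCne
    (f := fun z : E × E => ‖z.2‖) (by fun_prop)
  obtain ⟨B, hB⟩ := hC.exists_bound_of_continuousOn
    ((contDiffOn_elField hΩ hL hreg).continuousOn.mono fun z hz => (hsub hz).1)
  obtain ⟨h₀, hh₀, hle⟩ := exists_pos_forall_mul_le (B + 1) hε
  refine ⟨Prod.fst '' Metric.cthickening ε (closure U), hC.image continuous_fst, ?_, ‖y.2‖,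
    (hsub hy).2, h₀, hh₀, fun h hh hhle q hq hqU t ht => ?_⟩
  · rintro _ ⟨z, hz, rfl⟩
    exact (hsub hz).1.1
  · have hz := mem_cthickening_of_hasDerivWithinAt
      (z := fun s => (q s, derivWithin q (Icc 0 h) s)) (X := elField L)
      (fun s hs => hq.hasDerivWithinAt hQ hL hreg hh hs) (subset_closure hqU) hB
      ((norm_nonneg _).trans (hB y hy)) (hle h hh hhle) t ht
    exact ⟨⟨_, hz, rfl⟩, hymax hz⟩

end Flow

/-! ### Existence and uniqueness by contraction of the endpoint velocities -/

section CollocationEstimates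

variable {E : Type*} [NormedAddCommGroup E] [NormedSpace ℝ E]

/-- Stability of two-point Hermite interpolation of order `k` with constant `S`. -/
def HermiteStable (E : Type*) [NormedAddCommGroup E] [NormedSpace ℝ E] (k : ℕ) (S : ℝ) : Prop :=
  ∀ (h : ℝ), 0 < h → ∀ (a b : Fin k → E) (B : ℝ),
    (∀ i : Fin k, h ^ (i : ℕ) * ‖a i‖ ≤ B) → (∀ i : Fin k, h ^ (i : ℕ) * ‖b i‖ ≤ B) →
    ∀ t ∈ Icc 0 h, ‖hermiteInterpolant k h a b t‖ ≤ S * B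

/-- The Hermite interpolant of the second derivatives prescribed by the Euler-Lagrange equation at
the phase points `(x₀, v.1)` and `(x₁, v.2)`. -/
noncomputable def accelInterpolant (L : E × E → ℝ) (n : ℕ) (h : ℝ) (x₀ x₁ : E) (v : E × E) :
    ℝ → E :=
  hermiteInterpolant (n + 1) h (accelJet L (n + 1) (x₀, v.1)) (accelJet L (n + 1) (x₁, v.2))

/-- `p'' = accelInterpolant v` with boundary values `x₀`, `x₁`. -/
structure IsAccelCurve (L : E × E → ℝ) (n : ℕ) (h : ℝ) (x₀ x₁ : E) (v : E × E) (p : ℝ → E) :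
    Prop where
  differentiable : Differentiable ℝ p
  differentiable_deriv : Differentiable ℝ (deriv p)
  deriv_deriv : deriv (deriv p) = accelInterpolant L n h x₀ x₁ v
  left : p 0 = x₀
  right : p h = x₁

theorem discreteLagrangian_eq (L : E × E → ℝ) (m : ℕ) (h : ℝ) (p : ℝ → E) :
    discreteLagrangian L m h p =
      eulerMaclaurinChain m h (fun i => iteratedDeriv i (fun t => L (p t, deriv p t))) := by
  simp [discreteLagrangian, eulerMaclaurin, eulerMaclaurinChain]

variable {L : E × E → ℝ} {n : ℕ} {K : Set E} {R M S h : ℝ} {x₀ x₁ : E} {v w : E × E}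
  {p p' : ℝ → E}

theorem norm_accelInterpolant_sub_le (hB : PhaseBounds L n K R M) (hS : HermiteStable E (n + 1) S)
    (hh : 0 < h) (hh1 : h ≤ 1) (hx₀ : x₀ ∈ K) (hx₁ : x₁ ∈ K) (hv : ‖v‖ ≤ R) (hw : ‖w‖ ≤ R)
    {t : ℝ} (ht : t ∈ Icc 0 h) :
    ‖accelInterpolant L n h x₀ x₁ v t - accelInterpolant L n h x₀ x₁ w t‖ ≤
      S * (M * ‖v - w‖) := by
  rw [accelInterpolant, accelInterpolant, hermiteInterpolant_sub]
  refine hS h hh _ _ _ (fun i => ?_) (fun i => ?_) t ht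
  · refine (mul_le_of_le_one_left (norm_nonneg _) (pow_le_one₀ hh.le hh1)).trans ?_
    refine (hB.accel_lipschitz i (by omega) x₀ hx₀ v.1 w.1 ((norm_fst_le v).trans hv)
      ((norm_fst_le w).trans hw)).trans ?_
    exact mul_le_mul_of_nonneg_left (norm_fst_le (v - w)) hB.nonneg
  · refine (mul_le_of_le_one_left (norm_nonneg _) (pow_le_one₀ hh.le hh1)).trans ?_
    refine (hB.accel_lipschitz i (by omega) x₁ hx₁ v.2 w.2 ((norm_snd_le v).trans hv)
      ((norm_snd_le w).trans hw)).trans ?_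
    exact mul_le_mul_of_nonneg_left (norm_snd_le (v - w)) hB.nonneg

theorem norm_accelInterpolant_le (hB : PhaseBounds L n K R M) (hS : HermiteStable E (n + 1) S)
    (hh : 0 < h) (hh1 : h ≤ 1) (hx₀ : x₀ ∈ K) (hx₁ : x₁ ∈ K) (hv : ‖v‖ ≤ R)
    {t : ℝ} (ht : t ∈ Icc 0 h) : ‖accelInterpolant L n h x₀ x₁ v t‖ ≤ S * M := by
  refine hS h hh _ _ _ (fun i => ?_) (fun i => ?_) t ht
  · refine (mul_le_of_le_one_left (norm_nonneg _) (pow_le_one₀ hh.le hh1)).trans ?_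
    exact hB.accel_bound i (by omega) x₀ hx₀ v.1 ((norm_fst_le v).trans hv)
  · refine (mul_le_of_le_one_left (norm_nonneg _) (pow_le_one₀ hh.le hh1)).trans ?_
    exact hB.accel_bound i (by omega) x₁ hx₁ v.2 ((norm_snd_le v).trans hv)

theorem exists_isAccelCurve (L : E × E → ℝ) (n : ℕ) (hh : h ≠ 0) (x₀ x₁ : E) (v : E × E) :
    ∃ p, IsAccelCurve L n h x₀ x₁ v p := by
  obtain ⟨p, h1, h2, h3, h4, h5⟩ := exists_deriv_deriv_eq
    (hermiteInterpolant_mem_polyCurve (n + 1) h (accelJet L (n + 1) (x₀, v.1))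
      (accelJet L (n + 1) (x₁, v.2))) hh x₀ x₁
  exact ⟨p, h1, h2, h3, h4, h5⟩

theorem IsAccelCurve.hasDerivWithinAt (hp : IsAccelCurve L n h x₀ x₁ v p) (I : Set ℝ) (t : ℝ) :
    HasDerivWithinAt p (deriv p t) I t :=
  (hp.differentiable t).hasDerivAt.hasDerivWithinAt

theorem IsAccelCurve.hasDerivWithinAt_deriv (hp : IsAccelCurve L n h x₀ x₁ v p) (I : Set ℝ)
    (t : ℝ) : HasDerivWithinAt (deriv p) (accelInterpolant L n h x₀ x₁ v t) I t := by
  have := (hp.differentiable_deriv t).hasDerivAt.hasDerivWithinAt (s := I)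
  rwa [hp.deriv_deriv] at this

/-- Both curves have the same boundary values, so the difference of their second derivatives enters
with a factor `h`; the velocity map has Lipschitz constant `S * M * h`. -/
theorem IsAccelCurve.norm_deriv_sub_le (hp : IsAccelCurve L n h x₀ x₁ v p)
    (hp' : IsAccelCurve L n h x₀ x₁ w p') (hB : PhaseBounds L n K R M)
    (hS : HermiteStable E (n + 1) S) (hh : 0 < h) (hh1 : h ≤ 1) (hx₀ : x₀ ∈ K) (hx₁ : x₁ ∈ K)
    (hv : ‖v‖ ≤ R) (hw : ‖w‖ ≤ R) {s : ℝ} (hs : s ∈ Icc 0 h) :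
    ‖deriv p s - deriv p' s‖ ≤ S * (M * ‖v - w‖) * h :=
  norm_deriv_le_of_eq_zero hh (u := fun t => p t - p' t) (u₁ := fun t => deriv p t - deriv p' t)
    (fun t _ => (hp.hasDerivWithinAt _ t).sub (hp'.hasDerivWithinAt _ t))
    (fun t _ => (hp.hasDerivWithinAt_deriv _ t).sub (hp'.hasDerivWithinAt_deriv _ t))
    (fun _ ht => norm_accelInterpolant_sub_le hB hS hh hh1 hx₀ hx₁ hv hw ht)
    (by rw [hp.left, hp'.left, sub_self]) (by rw [hp.right, hp'.right, sub_self]) hs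

/-- The velocity differs from the chord slope by at most `S * M * h`. The gap `R - R'` absorbs this,
which gives invariance of the ball. -/
theorem IsAccelCurve.norm_deriv_le (hp : IsAccelCurve L n h x₀ x₁ v p)
    (hB : PhaseBounds L n K R M) (hS : HermiteStable E (n + 1) S) (hh : 0 < h) (hh1 : h ≤ 1)
    (hx₀ : x₀ ∈ K) (hx₁ : x₁ ∈ K) (hv : ‖v‖ ≤ R) {s : ℝ} (hs : s ∈ Icc 0 h) {R' : ℝ}
    (hx : ‖x₁ - x₀‖ ≤ R' * h) : ‖deriv p s‖ ≤ R' + S * M * h := by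
  have h1 := norm_sub_sub_smul_le hh.le (fun t _ => hp.hasDerivWithinAt (Icc 0 h) t)
    (fun t _ => hp.hasDerivWithinAt_deriv _ t)
    (fun t ht => norm_accelInterpolant_le hB hS hh hh1 hx₀ hx₁ hv ht) hs
  rw [hp.left, hp.right] at h1
  have h2 : ‖h • deriv p s‖ ≤ ‖x₁ - x₀‖ + ‖x₁ - x₀ - h • deriv p s‖ := by
    simpa using norm_sub_le (x₁ - x₀) (x₁ - x₀ - h • deriv p s)
  rw [norm_smul, Real.norm_eq_abs, abs_of_pos hh] at h2
  refine le_of_mul_le_mul_left ?_ hh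
  linarith

theorem IsAccelCurve.norm_sub_left_le (hp : IsAccelCurve L n h x₀ x₁ v p)
    (hB : PhaseBounds L n K R M) (hS : HermiteStable E (n + 1) S) (hh : 0 < h) (hh1 : h ≤ 1)
    (hx₀ : x₀ ∈ K) (hx₁ : x₁ ∈ K) (hv : ‖v‖ ≤ R) {R' : ℝ} (hx : ‖x₁ - x₀‖ ≤ R' * h)
    {t : ℝ} (ht : t ∈ Icc 0 h) : ‖p t - x₀‖ ≤ (R' + S * M * h) * h := by
  have hd := fun s (hs : s ∈ Icc 0 h) => hp.norm_deriv_le hB hS hh hh1 hx₀ hx₁ hv hs hx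
  have h1 := norm_image_sub_le_of_norm_deriv_le_segment'
    (fun s _ => hp.hasDerivWithinAt (Icc 0 h) s) (fun s hs => hd s (Ico_subset_Icc_self hs)) t ht
  rw [hp.left, sub_zero] at h1
  exact h1.trans (mul_le_mul_of_nonneg_left ht.2 ((norm_nonneg _).trans (hd t ht)))

/-- Existence of the velocities at the endpoints of a collocation curve, by contraction. -/
theorem exists_isAccelCurve_fixedPoint [CompleteSpace E] (hB : PhaseBounds L n K R M)
    (hS : HermiteStable E (n + 1) S) (hh : 0 < h) (hh1 : h ≤ 1) (hx₀ : x₀ ∈ K) (hx₁ : x₁ ∈ K)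
    (hR : 0 ≤ R) {R' : ℝ} (hx : ‖x₁ - x₀‖ ≤ R' * h) (hc : S * M * h ≤ 1 / 2)
    (hR' : R' + S * M * h ≤ R) :
    ∃ v : E × E, ‖v‖ ≤ R ∧ ∃ p, IsAccelCurve L n h x₀ x₁ v p ∧ v = (deriv p 0, deriv p h) := by
  choose P hP using fun v => exists_isAccelCurve L n hh.ne' x₀ x₁ v
  set Φ : E × E → E × E := fun v => (deriv (P v) 0, deriv (P v) h)
  have h0 : (0 : ℝ) ∈ Icc 0 h := left_mem_Icc.2 hh.le
  have hend : h ∈ Icc 0 h := right_mem_Icc.2 hh.le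
  have hmaps : MapsTo Φ (Metric.closedBall 0 R) (Metric.closedBall 0 R) := by
    intro v hv
    rw [mem_closedBall_zero_iff] at hv ⊢
    exact norm_prod_le_iff.2
      ⟨((hP v).norm_deriv_le hB hS hh hh1 hx₀ hx₁ hv h0 hx).trans hR',
        ((hP v).norm_deriv_le hB hS hh hh1 hx₀ hx₁ hv hend hx).trans hR'⟩
  have hlip : LipschitzOnWith (1 / 2) Φ (Metric.closedBall 0 R) := by
    refine LipschitzOnWith.of_dist_le_mul fun v hv w hw => ?_
    rw [mem_closedBall_zero_iff] at hv hw
    rw [dist_eq_norm, dist_eq_norm]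
    have hle : S * (M * ‖v - w‖) * h ≤ ((1 / 2 : NNReal) : ℝ) * ‖v - w‖ := by
      have := mul_le_mul_of_nonneg_right hc (norm_nonneg (v - w))
      push_cast
      linarith
    exact norm_prod_le_iff.2
      ⟨((hP v).norm_deriv_sub_le (hP w) hB hS hh hh1 hx₀ hx₁ hv hw h0).trans hle,
        ((hP v).norm_deriv_sub_le (hP w) hB hS hh hh1 hx₀ hx₁ hv hw hend).trans hle⟩
  have hcontr : ContractingWith (1 / 2) (hmaps.restrict Φ _ _) :=
    ⟨by rw [← NNReal.coe_lt_coe]; norm_num, hlip.mapsToRestrict hmaps⟩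
  obtain ⟨v, hv, hfix, -⟩ := ContractingWith.exists_fixedPoint'
    Metric.isClosed_closedBall.isComplete hmaps hcontr
    (Metric.mem_closedBall_self hR) (edist_ne_top _ _)
  exact ⟨v, mem_closedBall_zero_iff.1 hv, P v, hP v, hfix.symm⟩

/-- The distance between two fixed points is at most half of itself; equal velocities then give
equal second derivatives and boundary values. -/
theorem IsAccelCurve.eq_of_fixedPoint (hp : IsAccelCurve L n h x₀ x₁ v p)
    (hp' : IsAccelCurve L n h x₀ x₁ w p') (hv' : v = (deriv p 0, deriv p h))
    (hw' : w = (deriv p' 0, deriv p' h)) (hB : PhaseBounds L n K R M)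
    (hS : HermiteStable E (n + 1) S) (hh : 0 < h) (hh1 : h ≤ 1) (hx₀ : x₀ ∈ K) (hx₁ : x₁ ∈ K)
    (hv : ‖v‖ ≤ R) (hw : ‖w‖ ≤ R) (hc : S * M * h ≤ 1 / 2) : p = p' := by
  have hle : ‖v - w‖ ≤ S * (M * ‖v - w‖) * h := by
    have h1 := hp.norm_deriv_sub_le hp' hB hS hh hh1 hx₀ hx₁ hv hw (left_mem_Icc.2 hh.le)
    have h2 := hp.norm_deriv_sub_le hp' hB hS hh hh1 hx₀ hx₁ hv hw (right_mem_Icc.2 hh.le)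
    refine norm_prod_le_iff.2 ⟨?_, ?_⟩
    · rwa [Prod.fst_sub, congrArg Prod.fst hv', congrArg Prod.fst hw']
    · rwa [Prod.snd_sub, congrArg Prod.snd hv', congrArg Prod.snd hw']
  have h3 := mul_le_mul_of_nonneg_right hc (norm_nonneg (v - w))
  have h4 : ‖v - w‖ = 0 := le_antisymm (by linarith) (norm_nonneg _)
  obtain rfl : v = w := sub_eq_zero.1 (norm_eq_zero.1 h4)
  exact eq_of_deriv_deriv_eq hp.differentiable hp.differentiable_deriv hp'.differentiable
    hp'.differentiable_deriv (by rw [hp.deriv_deriv, hp'.deriv_deriv]) hh.ne'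
    (by rw [hp.left, hp'.left]) (by rw [hp.right, hp'.right])

theorem isCollocationCurve_iff_isAccelCurve [FiniteDimensional ℝ E] {Q : Set E} (hQ : IsOpen Q)
    (hL : ContDiffOn ℝ ((2 * (n + 2) : ℕ) : WithTop ℕ∞) L (Q ×ˢ univ))
    (hreg : IsRegularLagrangian Q L) (hh : h ≠ 0) (hx₀ : x₀ ∈ Q) (hx₁ : x₁ ∈ Q) :
    IsCollocationCurve L (n + 2) h x₀ x₁ p ↔
      IsAccelCurve L n h x₀ x₁ (deriv p 0, deriv p h) p := by
  rw [isCollocationCurve_iff hQ hL hreg hh hx₀ hx₁]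
  exact ⟨fun ⟨h1, h2, h3, h4, h5⟩ => ⟨h3, h4, h5, h1, h2⟩,
    fun ⟨h3, h4, h5, h1, h2⟩ => ⟨h1, h2, h3, h4, h5⟩⟩

end CollocationEstimates

/-! ### Comparison of the collocation curve with the solution -/

section ErrorEstimates

variable {E : Type*} [NormedAddCommGroup E] [NormedSpace ℝ E] [FiniteDimensional ℝ E]
  {Q : Set E} {L : E × E → ℝ} {n : ℕ} {K : Set E} {R M S h : ℝ} {q p : ℝ → E} {v : E × E}

theorem IsSolutionCurve.isDerivChain_accel (hQ : IsOpen Q)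
    (hL : ContDiffOn ℝ ((2 * (n + 2) : ℕ) : WithTop ℕ∞) L (Q ×ˢ univ))
    (hreg : IsRegularLagrangian Q L) (hh : 0 < h) (hq : IsSolutionCurve Q L h q) :
    IsDerivChain (2 * n + 2) h (fun i t => iterLieDeriv (elField L) i (accel L)
      (q t, derivWithin q (Icc 0 h) t)) := by
  have hΩ : IsOpen (Q ×ˢ (univ : Set E)) := hQ.prod isOpen_univ
  have hL' : ContDiffOn ℝ ((2 * n + 2) + 2 : ℕ) L (Q ×ˢ univ) := hL
  exact isDerivChain_iterLieDeriv hΩ (contDiffOn_accel hΩ hL' hreg)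
    (contDiffOn_elField hΩ hL' hreg) (by omega)
    (fun t ht => hq.hasDerivWithinAt hQ hL' hreg hh ht) (fun t ht => ⟨hq.mem t ht, mem_univ _⟩)

theorem IsSolutionCurve.isDerivChain_lagrangian (hQ : IsOpen Q)
    (hL : ContDiffOn ℝ ((2 * (n + 2) : ℕ) : WithTop ℕ∞) L (Q ×ˢ univ))
    (hreg : IsRegularLagrangian Q L) (hh : 0 < h) (hq : IsSolutionCurve Q L h q) :
    IsDerivChain (2 * n + 3) h (fun i t => iterLieDeriv (elField L) i L
      (q t, derivWithin q (Icc 0 h) t)) := by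
  have hΩ : IsOpen (Q ×ˢ (univ : Set E)) := hQ.prod isOpen_univ
  have hL' : ContDiffOn ℝ ((2 * n + 2) + 2 : ℕ) L (Q ×ˢ univ) := hL
  exact isDerivChain_iterLieDeriv hΩ (hL'.of_le (by norm_cast; omega))
    (contDiffOn_elField hΩ hL' hreg) (by omega)
    (fun t ht => hq.hasDerivWithinAt hQ hL' hreg hh ht) (fun t ht => ⟨hq.mem t ht, mem_univ _⟩)

/-- Hermite interpolation error for the acceleration of a solution curve. -/
theorem IsSolutionCurve.norm_accelInterpolant_sub_accel_le (hQ : IsOpen Q)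
    (hL : ContDiffOn ℝ ((2 * (n + 2) : ℕ) : WithTop ℕ∞) L (Q ×ˢ univ))
    (hreg : IsRegularLagrangian Q L) (hB : PhaseBounds L n K R M)
    (hS : HermiteStable E (n + 1) S) (hh : 0 < h) (hh1 : h ≤ 1) (hq : IsSolutionCurve Q L h q)
    (hqK : ∀ t ∈ Icc 0 h, q t ∈ K ∧ ‖derivWithin q (Icc 0 h) t‖ ≤ R) (hv : ‖v‖ ≤ R)
    {t : ℝ} (ht : t ∈ Icc 0 h) :
    ‖accelInterpolant L n h (q 0) (q h) v t - accel L (q t, derivWithin q (Icc 0 h) t)‖ ≤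
      S * (M * ‖v - (derivWithin q (Icc 0 h) 0, derivWithin q (Icc 0 h) h)‖ +
        M * h ^ (2 * n + 2)) + M * h ^ (2 * n + 2) := by
  set q' := derivWithin q (Icc 0 h)
  set w : E × E := (q' 0, q' h) with hwdef
  set y : ℕ → ℝ → E := fun i t => iterLieDeriv (elField L) i (accel L) (q t, q' t) with hy
  have h0 : (0 : ℝ) ∈ Icc 0 h := left_mem_Icc.2 hh.le
  have hend : h ∈ Icc 0 h := right_mem_Icc.2 hh.le
  have hyc : IsDerivChain (2 * n + 2) h y := hq.isDerivChain_accel hQ hL hreg hh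
  -- The Taylor polynomial of `q''` at `0` mediates: being its own Hermite interpolant, it is
  -- compared with `accelInterpolant` by stability and with `q''` by Taylor's estimate.
  obtain ⟨T, hT, hTi⟩ := exists_mem_polyCurve_iteratedDeriv_eq (2 * n + 2) fun i => y i 0
  have hTs : ∀ i t, HasDerivAt (iteratedDeriv i T) (iteratedDeriv (i + 1) T t) t := by
    intro i t
    rw [iteratedDeriv_succ]
    exact ((contDiff_of_mem_polyCurve hT ⊤).differentiable_iteratedDeriv i
      (by exact_mod_cast WithTop.coe_lt_top _) t).hasDerivAt
  have huc : IsDerivChain (2 * n + 2) h (fun i t => y i t - iteratedDeriv i T t) :=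
    ⟨fun i hi t ht => (hyc.hasDerivWithinAt i hi t ht).sub (hTs i t).hasDerivWithinAt,
      hyc.continuousOn_last.sub fun t _ => (hTs _ t).continuousAt.continuousWithinAt⟩
  have hub : ∀ {k : ℕ}, k ≤ 2 * n + 2 → ∀ t ∈ Icc 0 h,
      ‖y (2 * n + 2 - k) t - iteratedDeriv (2 * n + 2 - k) T t‖ ≤ M * h ^ k := by
    intro k hk
    refine huc.norm_le_of_zero hh.le (fun i hi => by rw [hTi i hi, sub_self]) (fun t ht => ?_) hk
    rw [iteratedDeriv_eq_zero_of_mem_polyCurve hT, Pi.zero_apply, sub_zero]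
    exact hB.accel_bound _ le_rfl _ (hqK t ht).1 _ (hqK t ht).2
  have hTH := eq_hermiteInterpolant_of_mem_polyCurve (n := n + 1) hh.ne' hT
  have hr : ‖accelInterpolant L n h (q 0) (q h) v t - T t‖ ≤
      S * (M * ‖v - w‖ + M * h ^ (2 * n + 2)) := by
    have hM := hB.nonneg
    rw [hTH, accelInterpolant, hermiteInterpolant_sub]
    refine hS h hh _ _ _ (fun i => ?_) (fun i => ?_) t ht
    · refine (mul_le_of_le_one_left (norm_nonneg _) (pow_le_one₀ hh.le hh1)).trans ?_
      rw [Pi.sub_apply, hTi i (by omega)]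
      refine (hB.accel_lipschitz i (by omega) _ (hqK 0 h0).1 v.1 (q' 0)
        ((norm_fst_le v).trans hv) (hqK 0 h0).2).trans ?_
      have h1 : M * ‖v.1 - q' 0‖ ≤ M * ‖v - w‖ :=
        mul_le_mul_of_nonneg_left (norm_fst_le (v - w)) hM
      have : 0 ≤ M * h ^ (2 * n + 2) := by positivity
      linarith
    -- At the right end `T` misses the `i`-th derivative by `M * h ^ (2 * n + 2 - i)`; the stability
    -- weight `h ^ i` restores the full power.
    · have h1 : ‖accelJet L (n + 1) (q h, v.2) i - y i h‖ ≤ M * ‖v - w‖ :=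
        (hB.accel_lipschitz i (by omega) _ (hqK h hend).1 v.2 (q' h)
          ((norm_snd_le v).trans hv) (hqK h hend).2).trans
          (mul_le_mul_of_nonneg_left (norm_snd_le (v - w)) hM)
      have h2 : ‖y i h - iteratedDeriv i T h‖ ≤ M * h ^ (2 * n + 2 - i) := by
        have := hub (k := 2 * n + 2 - i) (by omega) h hend
        rwa [show 2 * n + 2 - (2 * n + 2 - (i : ℕ)) = i by omega] at this
      have h3 : h ^ (2 * n + 2) = h ^ (i : ℕ) * h ^ (2 * n + 2 - i) := by
        rw [← pow_add]; congr 1; omega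
      calc _ ≤ h ^ (i : ℕ) * (M * ‖v - w‖ + M * h ^ (2 * n + 2 - i)) := by
            gcongr
            refine (norm_sub_le_norm_sub_add_norm_sub _ (y i h) _).trans (add_le_add h1 h2)
        _ = h ^ (i : ℕ) * (M * ‖v - w‖) + M * h ^ (2 * n + 2) := by rw [h3]; ring
        _ ≤ _ := by
            have : 0 ≤ M * ‖v - w‖ := by positivity
            exact add_le_add (mul_le_of_le_one_left this (pow_le_one₀ hh.le hh1)) le_rfl
  have hu0 := hub (k := 2 * n + 2) le_rfl t ht
  rw [Nat.sub_self, iteratedDeriv_zero, norm_sub_rev] at hu0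
  exact (norm_sub_le_norm_sub_add_norm_sub _ (T t) _).trans (add_le_add hr hu0)

/-- The endpoint velocities of a collocation curve agree with those of the solution curve up to
`O(h ^ (2n + 3))`. -/
theorem IsAccelCurve.norm_sub_derivWithin_le (hQ : IsOpen Q)
    (hL : ContDiffOn ℝ ((2 * (n + 2) : ℕ) : WithTop ℕ∞) L (Q ×ˢ univ))
    (hreg : IsRegularLagrangian Q L) (hB : PhaseBounds L n K R M)
    (hS : HermiteStable E (n + 1) S) (hh : 0 < h) (hh1 : h ≤ 1) (hq : IsSolutionCurve Q L h q)
    (hqK : ∀ t ∈ Icc 0 h, q t ∈ K ∧ ‖derivWithin q (Icc 0 h) t‖ ≤ R)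
    (hp : IsAccelCurve L n h (q 0) (q h) v p) (hv' : v = (deriv p 0, deriv p h)) (hv : ‖v‖ ≤ R)
    (hc : S * M * h ≤ 1 / 2) :
    ‖v - (derivWithin q (Icc 0 h) 0, derivWithin q (Icc 0 h) h)‖ ≤
      2 * (S + 1) * M * h ^ (2 * n + 3) := by
  have hL' : ContDiffOn ℝ ((2 * n + 2) + 2 : ℕ) L (Q ×ˢ univ) := hL
  set q' := derivWithin q (Icc 0 h)
  set w : E × E := (q' 0, q' h) with hwdef
  have hz := fun t ht => hq.hasDerivWithinAt hQ hL' hreg hh (t := t) ht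
  have key := fun s hs => norm_deriv_le_of_eq_zero hh (u := fun t => p t - q t)
    (u₁ := fun t => deriv p t - q' t) (s := s)
    (fun t ht => (hp.hasDerivWithinAt _ t).sub
      ((ContinuousLinearMap.fst ℝ E E).hasFDerivAt.comp_hasDerivWithinAt t (hz t ht)))
    (fun t ht => (hp.hasDerivWithinAt_deriv _ t).sub
      ((ContinuousLinearMap.snd ℝ E E).hasFDerivAt.comp_hasDerivWithinAt t (hz t ht)))
    (fun t ht => hq.norm_accelInterpolant_sub_accel_le hQ hL hreg hB hS hh hh1 hqK hv ht)
    (by rw [hp.left, sub_self]) (by rw [hp.right, sub_self]) hs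
  have hle : ‖v - w‖ ≤ (S * (M * ‖v - w‖ + M * h ^ (2 * n + 2)) + M * h ^ (2 * n + 2)) * h := by
    refine norm_prod_le_iff.2 ⟨?_, ?_⟩
    · have := key 0 (left_mem_Icc.2 hh.le)
      rwa [Prod.fst_sub, congrArg Prod.fst hv']
    · have := key h (right_mem_Icc.2 hh.le)
      rwa [Prod.snd_sub, congrArg Prod.snd hv']
  -- The unknown error occurs on the right with coefficient `S * M * h ≤ 1 / 2`; absorbing it costs
  -- the factor `2`.
  have h3 := mul_le_mul_of_nonneg_right hc (norm_nonneg (v - w))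
  have h4 : h ^ (2 * n + 3) = h ^ (2 * n + 2) * h := pow_succ _ _
  rw [h4]
  linarith

/-- The error of the discrete Lagrangian is controlled by the error of the Euler-Maclaurin formula
along the exact solution. -/
theorem abs_discreteLagrangian_sub_exact_le (hQ : IsOpen Q)
    (hL : ContDiffOn ℝ ((2 * (n + 2) : ℕ) : WithTop ℕ∞) L (Q ×ˢ univ))
    (hreg : IsRegularLagrangian Q L) (hB : PhaseBounds L n K R M) (hKQ : K ⊆ Q)
    (hS : HermiteStable E (n + 1) S) (hS0 : 0 ≤ S) {m e : ℕ} {c c' : ℝ} (hc0 : 0 ≤ c)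
    (hm : 2 * m ≤ n + 2) (he : e ≤ 2 * n + 4)
    (hEM : ∀ (h : ℝ), 0 < h → h ≤ 1 → ∀ (γ δ : ℕ → ℝ → ℝ) (B : ℝ),
      (∀ i ≤ 2 * m - 1, |γ i 0 - δ i 0| ≤ B) → (∀ i ≤ 2 * m - 1, |γ i h - δ i h| ≤ B) →
      |eulerMaclaurinChain m h γ - eulerMaclaurinChain m h δ| ≤ c * B * h)
    (hEM' : ∀ (h : ℝ), 0 < h → ∀ (γ : ℕ → ℝ → ℝ) (B : ℝ), IsDerivChain (2 * n + 3) h γ →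
      (∀ i ≤ 2 * n + 3, ∀ t ∈ Icc 0 h, |γ i t| ≤ B) →
      |eulerMaclaurinChain m h γ - ∫ t in (0 : ℝ)..h, γ 0 t| ≤ c' * B * h ^ e)
    (hh : 0 < h) (hh1 : h ≤ 1) (hq : IsSolutionCurve Q L h q)
    (hqK : ∀ t ∈ Icc 0 h, q t ∈ K ∧ ‖derivWithin q (Icc 0 h) t‖ ≤ R)
    (hp : IsCollocationCurve L (n + 2) h (q 0) (q h) p) (hv : ‖(deriv p 0, deriv p h)‖ ≤ R)
    (hc : S * M * h ≤ 1 / 2) :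
    |discreteLagrangian L m h p - exactDiscreteLagrangian L h q| ≤
      (c * (M * (2 * (S + 1) * M)) + c' * M) * h ^ e := by
  have hM := hB.nonneg
  have h0 : (0 : ℝ) ∈ Icc 0 h := left_mem_Icc.2 hh.le
  have hend : h ∈ Icc 0 h := right_mem_Icc.2 hh.le
  have hx₀ := hqK 0 h0
  have hx₁ := hqK h hend
  have hacc := (isCollocationCurve_iff_isAccelCurve hQ hL hreg hh.ne' (hKQ hx₀.1)
    (hKQ hx₁.1)).1 hp
  have hvw := hacc.norm_sub_derivWithin_le hQ hL hreg hB hS hh hh1 hq hqK rfl hv hc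
  have hv0 : ‖deriv p 0‖ ≤ R := (norm_fst_le (deriv p 0, deriv p h)).trans hv
  have hv1 : ‖deriv p h‖ ≤ R := (norm_snd_le (deriv p 0, deriv p h)).trans hv
  have hvw0 := (norm_fst_le _).trans hvw
  have hvw1 := (norm_snd_le _).trans hvw
  -- Only derivatives of order at most `2 * m - 1 ≤ n + 1` enter, and up to that order the
  -- collocation curve has the flow's derivatives at its endpoints.
  have h1 := hEM h hh hh1 (fun i => iteratedDeriv i (fun t => L (p t, deriv p t)))
    (fun i t => iterLieDeriv (elField L) i L (q t, derivWithin q (Icc 0 h) t))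
    (M * (2 * (S + 1) * M * h ^ (2 * n + 3)))
    (fun i hi => by
      rw [(hp.iteratedDeriv_lagrangian hQ hL hreg (hKQ hx₀.1) (hKQ hx₁.1) (i := i) (by omega)).1]
      exact (hB.lagrangian_lipschitz i (by omega) _ hx₀.1 _ _ hv0 hx₀.2).trans
        (mul_le_mul_of_nonneg_left hvw0 hM))
    (fun i hi => by
      rw [(hp.iteratedDeriv_lagrangian hQ hL hreg (hKQ hx₀.1) (hKQ hx₁.1) (i := i) (by omega)).2]
      exact (hB.lagrangian_lipschitz i (by omega) _ hx₁.1 _ _ hv1 hx₁.2).trans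
        (mul_le_mul_of_nonneg_left hvw1 hM))
  have h2 := hEM' h hh
    (fun i t => iterLieDeriv (elField L) i L (q t, derivWithin q (Icc 0 h) t)) M
    (hq.isDerivChain_lagrangian hQ hL hreg hh)
    (fun i hi t ht => hB.lagrangian_bound i hi _ (hqK t ht).1 _ (hqK t ht).2)
  rw [← discreteLagrangian_eq] at h1
  have h3 : h ^ (2 * n + 4) ≤ h ^ e := pow_le_pow_of_le_one hh.le hh1 he
  refine (abs_sub_le _ _ _).trans ((add_le_add h1 h2).trans ?_)
  calc _ = c * (M * (2 * (S + 1) * M)) * h ^ (2 * n + 4) + c' * M * h ^ e := by ring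
    _ ≤ c * (M * (2 * (S + 1) * M)) * h ^ e + c' * M * h ^ e := by gcongr
    _ = _ := by ring

end ErrorEstimates

/-! ### Assembly of the constants and the main estimate -/

section Main

variable {E : Type*} [NormedAddCommGroup E] [NormedSpace ℝ E] [FiniteDimensional ℝ E]

/-- Existence and uniqueness of collocation curves of degree at most `2 (n + 2) - 1`, and the error
of the discrete Lagrangians with `(n + 2) / 2`, with no, and with one correction term. -/
theorem exists_collocation_estimates (n : ℕ) {Q : Set E} (hQ : IsOpen Q) {L : E × E → ℝ}
    (hL : ContDiffOn ℝ ((2 * (n + 2) : ℕ) : WithTop ℕ∞) L (Q ×ˢ univ))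
    (hreg : IsRegularLagrangian Q L) {U : Set (E × E)} (hUc : IsCompact (closure U))
    (hUQ : closure U ⊆ Q ×ˢ univ) {R : ℝ} (hR : ∀ z ∈ closure U, ‖z.2‖ < R) :
    ∃ C h₀ : ℝ, 0 < h₀ ∧ ∀ h : ℝ, 0 < h → h ≤ h₀ →
      ∀ q : ℝ → E, IsSolutionCurve Q L h q → (q 0, derivWithin q (Icc 0 h) 0) ∈ U →
        (∃! p : ℝ → E, IsCollocationCurve L (n + 2) h (q 0) (q h) p ∧
          ‖deriv p 0‖ ≤ R ∧ ‖deriv p h‖ ≤ R) ∧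
        ∀ p : ℝ → E, IsCollocationCurve L (n + 2) h (q 0) (q h) p →
          ‖deriv p 0‖ ≤ R → ‖deriv p h‖ ≤ R →
          (∀ t ∈ Icc 0 h, p t ∈ Q) ∧
          (1 ≤ n → |discreteLagrangian L ((n + 2) / 2) h p - exactDiscreteLagrangian L h q| ≤
            C * h ^ (2 * ((n + 2) / 2) + 3)) ∧
          |discreteLagrangian L 0 h p - exactDiscreteLagrangian L h q| ≤ C * h ^ 3 ∧
          |discreteLagrangian L 1 h p - exactDiscreteLagrangian L h q| ≤ C * h ^ 3 := by
  have := FiniteDimensional.complete ℝ E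
  have := FiniteDimensional.proper ℝ E
  rcases U.eq_empty_or_nonempty with rfl | hUne
  · exact ⟨0, 1, one_pos, fun h _ _ q _ hq => absurd hq (notMem_empty _)⟩
  have hR0 : 0 ≤ R := by
    obtain ⟨z, hz⟩ := hUne
    exact (norm_nonneg _).trans (hR z (subset_closure hz)).le
  have hL' : ContDiffOn ℝ ((2 * n + 2) + 2 : ℕ) L (Q ×ˢ univ) := hL
  obtain ⟨K, hK, hKQ, R', hR', h₁, hh₁, H₁⟩ :=
    exists_compact_of_isSolutionCurve hQ hL' hreg hUne hUc hUQ hR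
  obtain ⟨M, hB⟩ := exists_phaseBounds (n := n) hQ hL hreg hK hKQ R
  have hM := hB.nonneg
  obtain ⟨S, hS0, hS⟩ := exists_norm_hermiteInterpolant_le (E := E) (n + 1)
  obtain ⟨η, hη, hηQ⟩ := hK.exists_cthickening_subset_open hQ hKQ
  obtain ⟨h₂, hh₂, H₂⟩ := exists_pos_forall_mul_le (S * M) (d := 1 / 2) (by norm_num)
  obtain ⟨h₃, hh₃, H₃⟩ := exists_pos_forall_mul_le (S * M) (sub_pos.2 hR')
  obtain ⟨h₄, hh₄, H₄⟩ := exists_pos_forall_mul_le R hη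
  obtain ⟨c, hc0, hc⟩ := exists_abs_eulerMaclaurinChain_sub_le ((n + 2) / 2)
  obtain ⟨c₀, hc₀0, hc₀⟩ := exists_abs_eulerMaclaurinChain_sub_le 0
  obtain ⟨c₁, hc₁0, hc₁⟩ := exists_abs_eulerMaclaurinChain_sub_le 1
  obtain ⟨d, hd0, hd⟩ := exists_abs_eulerMaclaurinChain_sub_integral_le ((n + 2) / 2)
  obtain ⟨d₀, hd₀0, hd₀⟩ := exists_abs_eulerMaclaurinChain_sub_integral_le 0
  -- One correction term is estimated with the remainder of order two, so that it also covers `n =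
  -- 0`.
  obtain ⟨d₁, hd₁0, hd₁⟩ := exists_abs_eulerMaclaurinChain_succ_sub_integral_le 0
  set B : ℝ := M * (2 * (S + 1) * M)
  have hB0 : 0 ≤ B := by positivity
  refine ⟨(c * B + d * M) + (c₀ * B + d₀ * M) + (c₁ * B + d₁ * M),
    min (min 1 h₁) (min h₂ (min h₃ h₄)), by positivity, fun h hh hle q hq hqU => ?_⟩
  simp only [le_min_iff] at hle
  obtain ⟨⟨hh1, hle₁⟩, hle₂, hle₃, hle₄⟩ := hle
  have h0 : (0 : ℝ) ∈ Icc 0 h := left_mem_Icc.2 hh.le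
  have hend : h ∈ Icc 0 h := right_mem_Icc.2 hh.le
  have hqK' := H₁ h hh hle₁ q hq hqU
  have hqK : ∀ t ∈ Icc 0 h, q t ∈ K ∧ ‖derivWithin q (Icc 0 h) t‖ ≤ R := fun t ht =>
    ⟨(hqK' t ht).1, (hqK' t ht).2.trans hR'.le⟩
  have hx₀ := (hqK 0 h0).1
  have hx₁ := (hqK h hend).1
  have hx : ‖q h - q 0‖ ≤ R' * h := by
    simpa using norm_image_sub_le_of_norm_deriv_le_segment
      (hq.contDiffOn.differentiableOn (by norm_num))
      (fun t ht => (hqK' t (Ico_subset_Icc_self ht)).2) h hend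
  have hc2 := H₂ h hh hle₂
  have hc3 : R' + S * M * h ≤ R := by linarith [H₃ h hh hle₃]
  have hiff := fun p : ℝ → E => isCollocationCurve_iff_isAccelCurve (p := p) hQ hL hreg hh.ne'
    (hKQ hx₀) (hKQ hx₁)
  refine ⟨?_, fun p hp hp0 hp1 => ?_⟩
  · obtain ⟨v, hv, p, hp, hvp⟩ := exists_isAccelCurve_fixedPoint hB hS hh hh1 hx₀ hx₁ hR0 hx hc2 hc3
    subst hvp
    refine ⟨p, ⟨(hiff p).2 hp, norm_prod_le_iff.1 hv⟩, fun p' ⟨hp', hp0', hp1'⟩ => ?_⟩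
    exact ((hiff p').1 hp').eq_of_fixedPoint hp rfl rfl hB hS hh hh1 hx₀ hx₁
      (norm_prod_le_iff.2 ⟨hp0', hp1'⟩) hv hc2
  · have hv : ‖(deriv p 0, deriv p h)‖ ≤ R := norm_prod_le_iff.2 ⟨hp0, hp1⟩
    refine ⟨fun t ht => hηQ ?_, fun hn => ?_, ?_, ?_⟩
    -- The curve stays within `R * h ≤ η` of its starting point, hence in the thickening of `K`
    -- contained in `Q`.
    · refine Metric.mem_cthickening_of_dist_le _ _ _ _ hx₀ ?_
      rw [dist_eq_norm]
      refine (((hiff p).1 hp).norm_sub_left_le hB hS hh hh1 hx₀ hx₁ hv hx ht).trans ?_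
      exact (mul_le_mul_of_nonneg_right hc3 hh.le).trans (H₄ h hh hle₄)
    -- `1 ≤ n` is used twice: for `2 * ((n + 2) / 2) + 3 ≤ 2 * n + 4`, and so that the `2 * ((n + 2)
    -- / 2 + 1)` derivatives in the remainder are among the `2 * n + 3` available.
    · refine (abs_discreteLagrangian_sub_exact_le hQ hL hreg hB hKQ hS hS0 hc0 (by omega)
        (by omega) hc (fun h hh γ B hγ hγB => hd h hh γ B (hγ.mono (by omega))
          (hγB _ (by omega))) hh hh1 hq hqK hp hv hc2).trans ?_
      refine mul_le_mul_of_nonneg_right (?_ : c * B + d * M ≤ _) (pow_nonneg hh.le _)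
      linarith [mul_nonneg hc₀0 hB0, mul_nonneg hd₀0 hM, mul_nonneg hc₁0 hB0, mul_nonneg hd₁0 hM]
    · refine (abs_discreteLagrangian_sub_exact_le hQ hL hreg hB hKQ hS hS0 hc₀0 (by omega)
        (by omega) hc₀ (fun h hh γ B hγ hγB => hd₀ h hh γ B (hγ.mono (by omega))
          (hγB _ (by omega))) hh hh1 hq hqK hp hv hc2).trans ?_
      refine mul_le_mul_of_nonneg_right (?_ : c₀ * B + d₀ * M ≤ _) (pow_nonneg hh.le _)
      linarith [mul_nonneg hc0 hB0, mul_nonneg hd0 hM, mul_nonneg hc₁0 hB0, mul_nonneg hd₁0 hM]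
    · refine (abs_discreteLagrangian_sub_exact_le hQ hL hreg hB hKQ hS hS0 hc₁0 (by omega)
        (by omega) hc₁ (fun h hh γ B hγ hγB => hd₁ h hh γ B (hγ.mono (by omega))
          (hγB _ (by omega))) hh hh1 hq hqK hp hv hc2).trans ?_
      refine mul_le_mul_of_nonneg_right (?_ : c₁ * B + d₁ * M ≤ _) (pow_nonneg hh.le _)
      linarith [mul_nonneg hc0 hB0, mul_nonneg hd0 hM, mul_nonneg hc₀0 hB0, mul_nonneg hd₀0 hM]

end Main

end PCVariational

theorem mainTheorem1 {E : Type*} [NormedAddCommGroup E] [NormedSpace ℝ E] [FiniteDimensional ℝ E]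
    (n : ℕ) (hn : 2 ≤ n) (Q : Set E) (hQ : IsOpen Q) (L : E × E → ℝ)
    (hL : ContDiffOn ℝ ((2 * n : ℕ) : WithTop ℕ∞) L (Q ×ˢ univ))
    (hreg : PCVariational.IsRegularLagrangian Q L)
    (U : Set (E × E)) (hU : IsOpen U) (hUc : IsCompact (closure U))
    (hUQ : closure U ⊆ Q ×ˢ univ)
    (R : ℝ) (hR : ∀ z ∈ closure U, ‖z.2‖ < R) :
    ∃ C h₀ : ℝ, 0 < h₀ ∧ ∀ h : ℝ, 0 < h → h ≤ h₀ →
      ∀ q : ℝ → E, PCVariational.IsSolutionCurve Q L h q →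
        (q 0, derivWithin q (Icc 0 h) 0) ∈ U →
        (∃! p : ℝ → E, PCVariational.IsCollocationCurve L n h (q 0) (q h) p ∧
          ‖deriv p 0‖ ≤ R ∧ ‖deriv p h‖ ≤ R) ∧
        ∀ p : ℝ → E, PCVariational.IsCollocationCurve L n h (q 0) (q h) p →
          ‖deriv p 0‖ ≤ R → ‖deriv p h‖ ≤ R →
          (∀ t ∈ Icc 0 h, p t ∈ Q) ∧
          (3 ≤ n →
            |PCVariational.discreteLagrangian L (n / 2) h p
              - PCVariational.exactDiscreteLagrangian L h q| ≤ C * h ^ (2 * (n / 2) + 3)) ∧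
          (3 ≤ n → Even n →
            |PCVariational.discreteLagrangian L (n / 2) h p
              - PCVariational.exactDiscreteLagrangian L h q| ≤ C * h ^ (n + 3)) ∧
          (3 ≤ n → Odd n →
            |PCVariational.discreteLagrangian L (n / 2) h p
              - PCVariational.exactDiscreteLagrangian L h q| ≤ C * h ^ (n + 2)) ∧
          (n = 2 →
            |PCVariational.discreteLagrangian L 0 h p
              - PCVariational.exactDiscreteLagrangian L h q| ≤ C * h ^ 3 ∧
            |PCVariational.discreteLagrangian L (n / 2) h p
              - PCVariational.exactDiscreteLagrangian L h q| ≤ C * h ^ 3) := by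
  obtain ⟨n, rfl⟩ : ∃ k, n = k + 2 := ⟨n - 2, by omega⟩
  obtain ⟨C, h₀, hh₀, H⟩ :=
    PCVariational.exists_collocation_estimates n hQ hL hreg hUc hUQ hR
  refine ⟨C, h₀, hh₀, fun h hh hle q hq hqU => ?_⟩
  obtain ⟨hex, hall⟩ := H h hh hle q hq hqU
  refine ⟨hex, fun p hp hp0 hp1 => ?_⟩
  obtain ⟨hpQ, hm, htrap, hone⟩ := hall p hp hp0 hp1
  refine ⟨hpQ, fun hn => hm (by omega), fun hn he => ?_, fun hn ho => ?_, fun hn => ⟨htrap, ?_⟩⟩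
  · have h1 := hm (by omega)
    rwa [Nat.two_mul_div_two_of_even he] at h1
  · have h1 := hm (by omega)
    have e : 2 * ((n + 2) / 2) + 3 = n + 2 + 2 := by
      obtain ⟨k, hk⟩ := ho
      omega
    rwa [e] at h1
  · obtain rfl : n = 0 := by omega
    exact hone
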